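/- Theorem 4.5 (Online Learning of Smooth MWIS). An MWIS instance $x$ on $n$ vertices is an undirected graph on $[n]$ with vertex weights $w_v$. For $\rho\in[0,1]$ let $A_\rho$ be the greedy heuristic that, starting with all vertices unblocked, repeatedly adds to its solution an unblocked vertex $v$ maximizing $w_v/(1+\deg v)^{\rho}$ (ties broken by smallest index) and blocks $v$ and its neighbours. Here $\deg v$ is the degree in the whole graph (non-adaptive version) or in the subgraph induced by the currently unblocked vertices (adaptive version). Let $\mathrm{cost}(A_\rho,x)$ be the total weight of the returned independent set (to be maximized). Let $0<\sigma<1$. A sequence $x_1,x_2,\dots$ of instances is $\sigma$-smooth if the graphs on $[n]$ are arbitrary and the weights $w_{t,v}$ are independent, each drawn from an arbitrary distribution $\Delta_{t,v}$ with support in $[0,1]$ and density at most $1/\sigma$; the graphs and distributions are fixed in advance and unknown to the learner. In round $t$ an online learning algorithm, which knows $n$ and $\sigma$, chooses $\rho_t\in[0,1]$ knowing only $x_1,\dots,x_{t-1}$ and its own random draws (which are independent of the weights), and then sees $x_t$. Its regret after $T$ rounds is $$R_T=\frac1T\Big(\sup_{\rho\in[0,1]}\sum_{t=1}^T \mathrm{cost}(A_\rho,x_t)-\sum_{t=1}^T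 \mathrm{cost}(A_{\rho_t},x_t)\Big).$$ For each of the two versions of the heuristic and every $d\in\mathbb N$ there are an online learning algorithm (one program for a randomized real RAM, that is, a machine with exact unit-cost arithmetic and comparisons of reals and unit-cost uniform random draws from $[0,1]$) and a constant $C$ such that for all $n\ge1$ and $\sigma\in(0,1)$: 1. on all instance sequences with weights in $[0,1]$ and for all outcomes of the draws, the initialization and every round take at most $C(n+1/\sigma)^C$ steps each; 2. for every $\sigma$-smooth sequence and every $T\ge C(n+1/\sigma)^C$, the expected regret (over the weights and the random draws) satisfies $\mathbb E[R_T]\le n^{-d}$. -/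

import Mathlib

open MeasureTheory Set
open scoped ENNReal

noncomputable section

/-! The greedy heuristics for maximum-weight independent set (MWIS). -/

/-- An MWIS instance on the vertex set `Fin n`: an undirected graph with vertex weights. -/
structure MWISInstance (n : ℕ) where
  graph : SimpleGraph (Fin n)
  weight : Fin n → ℝ

/-- Whether `deg v` is taken in the original graph (`nonadaptive`), or in the subgraph induced by
the vertices that are not yet blocked from consideration (`adaptive`). -/
inductive GreedyVariant where
  | nonadaptive
  | adaptive

namespace MWISInstance

variable {n : ℕ}

open Classical in
/-- The degree of `v` that the heuristic uses when `S` is the set of vertices still under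
consideration. -/
def deg (V : GreedyVariant) (x : MWISInstance n) (S : Finset (Fin n)) (v : Fin n) : ℕ :=
  match V with
  | .nonadaptive => (Finset.univ.filter fun u => x.graph.Adj v u).card
  | .adaptive => (S.filter fun u => x.graph.Adj v u).card

/-- The score `w_v / (1 + deg v) ^ ρ`. -/
def score (V : GreedyVariant) (ρ : ℝ) (x : MWISInstance n) (S : Finset (Fin n)) (v : Fin n) : ℝ :=
  x.weight v / (1 + (x.deg V S v : ℝ)) ^ ρ

open Classical in
/-- The vertices of `S` of largest score. -/
def best (V : GreedyVariant) (ρ : ℝ) (x : MWISInstance n) (S : Finset (Fin n)) :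
    Finset (Fin n) :=
  S.filter fun v => ∀ u ∈ S, x.score V ρ S u ≤ x.score V ρ S v

open Classical in
/-- At most `k` rounds of the greedy heuristic on the set `S` of unblocked vertices: take a vertex
of largest score (of several, the one of smallest index), block it and its neighbours, continue. -/
def greedy (V : GreedyVariant) (ρ : ℝ) (x : MWISInstance n) :
    ℕ → Finset (Fin n) → Finset (Fin n)
  | 0, _ => ∅
  | k + 1, S =>
    if h : (x.best V ρ S).Nonempty then
      let v := (x.best V ρ S).min' h
      insert v (greedy V ρ x k (S.filter fun u => u ≠ v ∧ ¬ x.graph.Adj v u))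
    else ∅

/-- The independent set returned by the heuristic `A_ρ`. Every round blocks at least one vertex, so
after `n` rounds none is left. -/
def output (V : GreedyVariant) (ρ : ℝ) (x : MWISInstance n) : Finset (Fin n) :=
  x.greedy V ρ n Finset.univ

/-- The performance (to be maximized) of `A_ρ` on `x`: the total weight of the returned set. -/
def cost (V : GreedyVariant) (ρ : ℝ) (x : MWISInstance n) : ℝ :=
  ∑ v ∈ x.output V ρ, x.weight v

end MWISInstance

/-- The regret after `T` rounds of the choices `ρ 0, ρ 1, …` on the instances `x 0, x 1, …`, against
the best fixed parameter in `[0, 1]`. -/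
def regret {n : ℕ} (V : GreedyVariant) (x : ℕ → MWISInstance n) (ρ : ℕ → ℝ) (T : ℕ) : ℝ :=
  (1 / (T : ℝ)) * ((⨆ r : Icc (0 : ℝ) 1, ∑ t ∈ Finset.range T, (x t).cost V r)
    - ∑ t ∈ Finset.range T, (x t).cost V (ρ t))

/-- `μ` has a density that is pointwise at most `1 / σ` and vanishes outside `[0, 1]`. -/
def IsSmooth (σ : ℝ) (μ : Measure ℝ) : Prop :=
  ∃ f : ℝ → ℝ≥0∞, Measurable f ∧ (∀ y, f y ≤ ENNReal.ofReal (1 / σ)) ∧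
    (∀ y, y ∉ Icc (0 : ℝ) 1 → f y = 0) ∧ μ = volume.withDensity f

/-! A randomized real RAM, programmed in a structured language. There are integer and real
registers, arranged in arrays. Real arithmetic is exact, and there is neither a rounding operation
nor any transcendental function; integers can only be added and subtracted. -/

namespace RealRAM

/-- Read-only input: the parameters `n` and `σ`, an adjacency matrix and a vector of weights. -/
structure Input where
  size : ℕ
  sigma : ℝ
  adj : ℕ → ℕ → ℕ
  weight : ℕ → ℝ

/-- The memory, with the number of random draws made and the number of steps taken so far. -/
structure Mem where
  nat : ℕ → ℕ → ℕ
  real : ℕ → ℕ → ℝ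
  draws : ℕ
  time : ℕ

/-- Integer expressions; `load a i` is the entry of index `i` of the integer array `a`, and `sub` is
truncated at `0`. -/
inductive NExp where
  | const (k : ℕ)
  | size
  | adj (i j : NExp)
  | load (a : ℕ) (i : NExp)
  | add (e f : NExp)
  | sub (e f : NExp)

/-- Real expressions; `load a i` is the entry of index `i` of the real array `a`. -/
inductive RExp where
  | const (q : ℚ)
  | cast (e : NExp)
  | sigma
  | weight (i : NExp)
  | load (a : ℕ) (i : NExp)
  | add (e f : RExp)
  | sub (e f : RExp)
  | mul (e f : RExp)
  | div (e f : RExp)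

/-- Programs. `setN a i e` and `setR a i e` store the value of `e` at index `i` of array `a`;
`draw a i` stores there a fresh uniform random number from `[0, 1]`; `ite e f c c'` runs `c` if
`e < f` and `c'` otherwise; `loop a e c` is the loop `for k = 0, 1, 2, … while k < e do c`, with `e`
evaluated once at the beginning and `k` stored at index `0` of the integer array `a`. -/
inductive Cmd where
  | skip
  | setN (a : ℕ) (i : NExp) (e : NExp)
  | setR (a : ℕ) (i : NExp) (e : RExp)
  | draw (a : ℕ) (i : NExp)
  | seq (c c' : Cmd)
  | ite (e f : RExp) (c c' : Cmd)
  | loop (a : ℕ) (e : RExp) (c : Cmd)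

def NExp.eval (I : Input) (m : Mem) : NExp → ℕ
  | .const k => k
  | .size => I.size
  | .adj i j => I.adj (i.eval I m) (j.eval I m)
  | .load a i => m.nat a (i.eval I m)
  | .add e f => e.eval I m + f.eval I m
  | .sub e f => e.eval I m - f.eval I m

/-- The number of steps that an evaluation takes: one for every operation. -/
def NExp.steps : NExp → ℕ
  | .const _ => 1
  | .size => 1
  | .adj i j => i.steps + j.steps + 1
  | .load _ i => i.steps + 1
  | .add e f => e.steps + f.steps + 1
  | .sub e f => e.steps + f.steps + 1

def RExp.eval (I : Input) (m : Mem) : RExp → ℝ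
  | .const q => q
  | .cast e => e.eval I m
  | .sigma => I.sigma
  | .weight i => I.weight (i.eval I m)
  | .load a i => m.real a (i.eval I m)
  | .add e f => e.eval I m + f.eval I m
  | .sub e f => e.eval I m - f.eval I m
  | .mul e f => e.eval I m * f.eval I m
  | .div e f => e.eval I m / f.eval I m

/-- The number of steps that an evaluation takes: one for every operation. -/
def RExp.steps : RExp → ℕ
  | .const _ => 1
  | .cast e => e.steps + 1
  | .sigma => 1
  | .weight i => i.steps + 1
  | .load _ i => i.steps + 1
  | .add e f => e.steps + f.steps + 1
  | .sub e f => e.steps + f.steps + 1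
  | .mul e f => e.steps + f.steps + 1
  | .div e f => e.steps + f.steps + 1

def Mem.storeN (m : Mem) (a i k : ℕ) : Mem :=
  { m with nat := Function.update m.nat a (Function.update (m.nat a) i k) }

def Mem.storeR (m : Mem) (a i : ℕ) (r : ℝ) : Mem :=
  { m with real := Function.update m.real a (Function.update (m.real a) i r) }

def Mem.tick (m : Mem) (k : ℕ) : Mem :=
  { m with time := m.time + k }

/-- The memory after a program has been run, where `U k` is the result of the `k`-th draw. A loop
with bound `y` makes `⌈y⌉₊` iterations, as `k < ⌈y⌉₊` holds exactly when `(k : ℝ) < y`; each costs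
one step more than its body, and one step pays for the last, failing test. -/
def Cmd.run (U : ℕ → unitInterval) (I : Input) : Cmd → Mem → Mem
  | .skip, m => m.tick 1
  | .setN a i e, m => (m.storeN a (i.eval I m) (e.eval I m)).tick (i.steps + e.steps + 1)
  | .setR a i e, m => (m.storeR a (i.eval I m) (e.eval I m)).tick (i.steps + e.steps + 1)
  | .draw a i, m =>
    { (m.storeR a (i.eval I m) (U m.draws)).tick (i.steps + 1) with draws := m.draws + 1 }
  | .seq c c', m => c'.run U I (c.run U I m)
  | .ite e f c c', m =>
    open Classical in
    if e.eval I m < f.eval I m then c.run U I (m.tick (e.steps + f.steps + 1))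
    else c'.run U I (m.tick (e.steps + f.steps + 1))
  | .loop a e c, m =>
    Nat.rec (motive := fun _ => Mem) (m.tick (e.steps + 1))
      (fun k m' => c.run U I ((m'.storeN a 0 k).tick 1)) ⌈e.eval I m⌉₊

end RealRAM

open RealRAM

/-! Online learning of the parameter `ρ` by a program. -/

/-- An online learning algorithm: `start` is run once; in every round, `choose` is run before the
instance of that round is revealed, and `update` after that. -/
structure Learner where
  start : Cmd
  choose : Cmd
  update : Cmd

/-- The input when no instance is shown: only the parameters `n` and `σ`. -/
def paramInput (n : ℕ) (σ : ℝ) : Input where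
  size := n
  sigma := σ
  adj := fun _ _ => 0
  weight := fun _ => 0

open Classical in
/-- The input that shows the instance `x`. -/
def instanceInput {n : ℕ} (σ : ℝ) (x : MWISInstance n) : Input where
  size := n
  sigma := σ
  adj := fun i j => if ∃ (hi : i < n) (hj : j < n), x.graph.Adj ⟨i, hi⟩ ⟨j, hj⟩ then 1 else 0
  weight := fun i => if hi : i < n then x.weight ⟨i, hi⟩ else 0

namespace Learner

variable {n : ℕ}

/-- The memory before round `t`. It depends on `x 0, …, x (t - 1)` only. -/
def memory (L : Learner) (σ : ℝ) (U : ℕ → unitInterval) (x : ℕ → MWISInstance n) : ℕ → Mem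
  | 0 => L.start.run U (paramInput n σ) ⟨fun _ _ => 0, fun _ _ => 0, 0, 0⟩
  | t + 1 => L.update.run U (instanceInput σ (x t))
      (L.choose.run U (paramInput n σ) (L.memory σ U x t))

/-- The parameter chosen for round `t`: the entry `0` of the real array `0` after `choose`. -/
def action (L : Learner) (σ : ℝ) (U : ℕ → unitInterval) (x : ℕ → MWISInstance n) (t : ℕ) : ℝ :=
  (L.choose.run U (paramInput n σ) (L.memory σ U x t)).real 0 0

end Learner

/-- The law of all vertex weights (indexed by round and vertex) and all random draws of the learner:
everything is independent, the weight of vertex `v` in round `t` has law `Δ t v`, and every draw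
is uniform on `[0, 1]`. -/
def smoothLaw {n : ℕ} (Δ : ℕ → Fin n → ProbabilityMeasure ℝ) :
    Measure ((ℕ → Fin n → ℝ) × (ℕ → unitInterval)) :=
  (Measure.infinitePi fun t => Measure.pi fun v => (Δ t v : Measure ℝ)).prod
    (Measure.infinitePi fun _ => (volume : Measure unitInterval))

/-- The sequence of instances with graphs `G t` and weights `w t`. -/
def instances {n : ℕ} (G : ℕ → SimpleGraph (Fin n)) (w : ℕ → Fin n → ℝ) (t : ℕ) :
    MWISInstance n :=
  ⟨G t, w t⟩

end

noncomputable section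

namespace RealRAM

/-! The learner runs multiplicative weights over the grid `i / N`, `i < N`, with `N = ⌈y ^ (d +
12)⌉₊`, `y = n + 1 / σ`, and learning rate `ε = 1 / y ^ (d + 4)`. This is a full-information
problem: once an instance is visible, the heuristic can be simulated at every grid point. The
machine has no powers with real exponents, but at `ρ = i / N` scores of nonnegative weights can be
compared through their `N`-th powers `w ^ N / (1 + deg) ^ i`, which take polynomially many
multiplications and divisions (`key_le_iff`, `run_greedyCmd`).

Against grid points, `hedge_regret_le` bounds the regret for every sequence of weights; averaging
over the draws turns the learner's cost into a weighted mean (`integral_pick`). No probabilistic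
assumption on the weights enters here.

Smoothness is needed to pass from the grid to all of `[0, 1]`. The greedy output depends on `ρ` only
through comparisons `w u * b ^ ρ ≤ w v * a ^ ρ` with integers `a`, `b` between `1` and `n`
(`cost_congr`). For `a < b` the order can change within the cell `[i / N, (i + 1) / N]` only if `w
v` lies between the values of `w u * (b / a) ^ ρ` at its endpoints. Given `w u`, this is an interval
of length at most `n ^ 2 / N`, so a union bound gives a crossing in a given cell with probability at
most `m = n ^ 6 / (N * σ)` (`measure_crossing_le`). Without a crossing the cost is constant on the
cell; with one it changes by at most `n`.

The best parameter depends on all weights, so the numbers of crossing rounds must be controlled in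
all cells at once. Rounds are independent, so each number has mean and variance at most `T * m`. The
sum of the `N` squared deviations bounds the largest one and has expectation at most `N * T * m = T
* n ^ 6 / σ`; with `z ≤ δ * T + z ^ 2 / (4 * δ * T)` this gives the bound of `integral_regret_le`,
which `regret_bound_le` evaluates for the chosen exponents. -/

/-! ### Invariants, frame rules and running times of programs. -/

@[simp] theorem Mem.storeN_nat (m : Mem) (a i k : ℕ) :
    (m.storeN a i k).nat = Function.update m.nat a (Function.update (m.nat a) i k) := rfl
@[simp] theorem Mem.storeN_real (m : Mem) (a i k : ℕ) : (m.storeN a i k).real = m.real := rfl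
@[simp] theorem Mem.storeN_draws (m : Mem) (a i k : ℕ) : (m.storeN a i k).draws = m.draws := rfl
@[simp] theorem Mem.storeN_time (m : Mem) (a i k : ℕ) : (m.storeN a i k).time = m.time := rfl
@[simp] theorem Mem.storeR_nat (m : Mem) (a i : ℕ) (r : ℝ) : (m.storeR a i r).nat = m.nat := rfl
@[simp] theorem Mem.storeR_real (m : Mem) (a i : ℕ) (r : ℝ) :
    (m.storeR a i r).real = Function.update m.real a (Function.update (m.real a) i r) := rfl
@[simp] theorem Mem.storeR_draws (m : Mem) (a i : ℕ) (r : ℝ) :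
    (m.storeR a i r).draws = m.draws := rfl
@[simp] theorem Mem.storeR_time (m : Mem) (a i : ℕ) (r : ℝ) :
    (m.storeR a i r).time = m.time := rfl
@[simp] theorem Mem.tick_nat (m : Mem) (k : ℕ) : (m.tick k).nat = m.nat := rfl
@[simp] theorem Mem.tick_real (m : Mem) (k : ℕ) : (m.tick k).real = m.real := rfl
@[simp] theorem Mem.tick_draws (m : Mem) (k : ℕ) : (m.tick k).draws = m.draws := rfl
@[simp] theorem Mem.tick_time (m : Mem) (k : ℕ) : (m.tick k).time = m.time + k := rfl

/-- Whether the program may write to the integer array `a`. -/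
def Cmd.writesNat (a : ℕ) : Cmd → Bool
  | .skip => false
  | .setN b _ _ => b == a
  | .setR _ _ _ => false
  | .draw _ _ => false
  | .seq c c' => c.writesNat a || c'.writesNat a
  | .ite _ _ c c' => c.writesNat a || c'.writesNat a
  | .loop b _ c => b == a || c.writesNat a

/-- Whether the program may write to the real array `a`. -/
def Cmd.writesReal (a : ℕ) : Cmd → Bool
  | .skip => false
  | .setN _ _ _ => false
  | .setR b _ _ => b == a
  | .draw b _ => b == a
  | .seq c c' => c.writesReal a || c'.writesReal a
  | .ite _ _ c c' => c.writesReal a || c'.writesReal a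
  | .loop _ _ c => c.writesReal a

/-- Whether the program may draw random numbers. -/
def Cmd.randomized : Cmd → Bool
  | .skip => false
  | .setN _ _ _ => false
  | .setR _ _ _ => false
  | .draw _ _ => true
  | .seq c c' => c.randomized || c'.randomized
  | .ite _ _ c c' => c.randomized || c'.randomized
  | .loop _ _ c => c.randomized

variable {U : ℕ → unitInterval} {I : Input}

theorem Cmd.run_loop_induction {a : ℕ} {e : RExp} {c : Cmd} {m : Mem} (P : ℕ → Mem → Prop)
    (h0 : P 0 (m.tick (e.steps + 1)))
    (hs : ∀ k m', k < ⌈e.eval I m⌉₊ → P k m' →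
      P (k + 1) (c.run U I ((m'.storeN a 0 k).tick 1))) :
    P ⌈e.eval I m⌉₊ ((Cmd.loop a e c).run U I m) := by
  have key : ∀ j ≤ ⌈e.eval I m⌉₊, P j (Nat.rec (motive := fun _ => Mem) (m.tick (e.steps + 1))
      (fun k m' => c.run U I ((m'.storeN a 0 k).tick 1)) j) := by
    intro j hj
    induction j with
    | zero => exact h0
    | succ j ih => exact hs j _ (by omega) (ih (by omega))
  exact key _ le_rfl

/-- Frame rule. The hypothesis is a syntactic check that evaluates, so for concrete programs it is
discharged by `rfl`. -/
theorem Cmd.run_nat {a : ℕ} {c : Cmd} (h : c.writesNat a = false) (m : Mem) :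
    (c.run U I m).nat a = m.nat a := by
  induction c generalizing m with
  | skip => rfl
  | setN b i e =>
    simp only [writesNat, beq_eq_false_iff_ne, ne_eq] at h
    simp [Cmd.run, Function.update_of_ne (Ne.symm h)]
  | setR b i e => rfl
  | draw b i => rfl
  | seq c c' ih ih' =>
    simp only [writesNat, Bool.or_eq_false_iff] at h
    rw [Cmd.run, ih' h.2, ih h.1]
  | ite e f c c' ih ih' =>
    simp only [writesNat, Bool.or_eq_false_iff] at h
    rw [Cmd.run]
    split_ifs
    · rw [ih h.1]; rfl
    · rw [ih' h.2]; rfl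
  | loop b e c ih =>
    simp only [writesNat, Bool.or_eq_false_iff, beq_eq_false_iff_ne, ne_eq] at h
    refine Cmd.run_loop_induction (fun _ m' => m'.nat a = m.nat a) rfl ?_
    intro k m' _ hm'
    rw [ih h.2]
    simp [Function.update_of_ne (Ne.symm h.1), hm']

theorem Cmd.run_real {a : ℕ} {c : Cmd} (h : c.writesReal a = false) (m : Mem) :
    (c.run U I m).real a = m.real a := by
  induction c generalizing m with
  | skip => rfl
  | setN b i e => rfl
  | setR b i e =>
    simp only [writesReal, beq_eq_false_iff_ne, ne_eq] at h
    simp [Cmd.run, Function.update_of_ne (Ne.symm h)]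
  | draw b i =>
    simp only [writesReal, beq_eq_false_iff_ne, ne_eq] at h
    simp [Cmd.run, Function.update_of_ne (Ne.symm h)]
  | seq c c' ih ih' =>
    simp only [writesReal, Bool.or_eq_false_iff] at h
    rw [Cmd.run, ih' h.2, ih h.1]
  | ite e f c c' ih ih' =>
    simp only [writesReal, Bool.or_eq_false_iff] at h
    rw [Cmd.run]
    split_ifs
    · rw [ih h.1]; rfl
    · rw [ih' h.2]; rfl
  | loop b e c ih =>
    refine Cmd.run_loop_induction (fun _ m' => m'.real a = m.real a) rfl ?_
    intro k m' _ hm'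
    rw [ih h]
    exact hm'

theorem Cmd.run_draws {c : Cmd} (h : c.randomized = false) (m : Mem) :
    (c.run U I m).draws = m.draws := by
  induction c generalizing m with
  | skip => rfl
  | setN b i e => rfl
  | setR b i e => rfl
  | draw b i => simp [randomized] at h
  | seq c c' ih ih' =>
    simp only [randomized, Bool.or_eq_false_iff] at h
    rw [Cmd.run, ih' h.2, ih h.1]
  | ite e f c c' ih ih' =>
    simp only [randomized, Bool.or_eq_false_iff] at h
    rw [Cmd.run]
    split_ifs
    · rw [ih h.1]; rfl
    · rw [ih' h.2]; rfl
  | loop b e c ih =>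
    refine Cmd.run_loop_induction (fun _ m' => m'.draws = m.draws) rfl ?_
    intro k m' _ hm'
    rw [ih h]
    exact hm'

/-- A bound for the running time if no loop makes more than `B` iterations. -/
def Cmd.timeBound (B : ℕ) : Cmd → ℕ
  | .skip => 1
  | .setN _ i e => i.steps + e.steps + 1
  | .setR _ i e => i.steps + e.steps + 1
  | .draw _ i => i.steps + 1
  | .seq c c' => c.timeBound B + c'.timeBound B
  | .ite e f c c' => e.steps + f.steps + 1 + c.timeBound B + c'.timeBound B
  | .loop _ e c => e.steps + 1 + B * (1 + c.timeBound B)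

/-- No loop makes more than `B` iterations as long as `N` is stored at index `0` of the integer
array `0`. -/
def Cmd.LoopsBounded (I : Input) (N B : ℕ) : Cmd → Prop
  | .seq c c' => c.LoopsBounded I N B ∧ c'.LoopsBounded I N B
  | .ite _ _ c c' => c.LoopsBounded I N B ∧ c'.LoopsBounded I N B
  | .loop _ e c => (∀ m : Mem, m.nat 0 0 = N → ⌈e.eval I m⌉₊ ≤ B) ∧ c.LoopsBounded I N B
  | _ => True

/-- Since array `0` is never written, not even as a loop counter, the value `N` survives and the
bounds in `LoopsBounded` stay applicable at every intermediate memory. -/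
theorem Cmd.run_time_le {c : Cmd} {N B : ℕ} (hw : c.writesNat 0 = false)
    (hc : c.LoopsBounded I N B) (m : Mem) (hm : m.nat 0 0 = N) :
    (c.run U I m).time ≤ m.time + c.timeBound B := by
  induction c generalizing m with
  | skip => exact le_rfl
  | setN b i e => exact le_rfl
  | setR b i e => exact le_rfl
  | draw b i => exact le_rfl
  | seq c c' ih ih' =>
    simp only [writesNat, Bool.or_eq_false_iff] at hw
    have h1 := ih hw.1 hc.1 m hm
    have h2 := ih' hw.2 hc.2 (c.run U I m) (by rw [Cmd.run_nat hw.1, hm])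
    simp only [Cmd.run, timeBound]
    omega
  | ite e f c c' ih ih' =>
    simp only [writesNat, Bool.or_eq_false_iff] at hw
    have h1 := ih hw.1 hc.1 (m.tick (e.steps + f.steps + 1)) hm
    have h2 := ih' hw.2 hc.2 (m.tick (e.steps + f.steps + 1)) hm
    simp only [Mem.tick_time] at h1 h2
    simp only [Cmd.run, timeBound]
    split_ifs <;> omega
  | loop b e c ih =>
    simp only [writesNat, Bool.or_eq_false_iff, beq_eq_false_iff_ne, ne_eq] at hw
    have hB := hc.1 m hm
    have := Cmd.run_loop_induction (U := U) (I := I) (a := b) (e := e) (c := c) (m := m)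
      (fun k m' => m'.nat 0 0 = N ∧
        m'.time ≤ m.time + (e.steps + 1) + k * (1 + c.timeBound B))
      ⟨hm, by simp⟩ (by
        rintro k m' _ ⟨h1, h2⟩
        have h3 : (((m'.storeN b 0 k).tick 1).nat 0 0) = N := by
          simp [Function.update_of_ne (Ne.symm hw.1), h1]
        refine ⟨by rw [Cmd.run_nat hw.2, h3], ?_⟩
        have h4 := ih hw.2 hc.2 _ h3
        simp only [Mem.tick_time, Mem.storeN_time] at h4
        rw [Nat.succ_mul]
        omega)
    refine this.2.trans ?_
    have := Nat.mul_le_mul_right (1 + c.timeBound B) hB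
    simp only [timeBound]
    omega

/-- For a fixed program the bound is a polynomial in `B`: bounds of the form `K * (B + 1) ^ K`
absorb constants, sums and multiplication by `B`. -/
theorem Cmd.exists_timeBound_le (c : Cmd) : ∃ K : ℕ, ∀ B, c.timeBound B ≤ K * (B + 1) ^ K := by
  have mono : ∀ K L B : ℕ, K ≤ L → K * (B + 1) ^ K ≤ L * (B + 1) ^ L := fun K L B h =>
    Nat.mul_le_mul h (Nat.pow_le_pow_right (by omega) h)
  have one : ∀ K B : ℕ, K ≤ K * (B + 1) ^ K := fun K B =>
    Nat.le_mul_of_pos_right _ (by positivity)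
  have add : ∀ K L B : ℕ, K * (B + 1) ^ K + L * (B + 1) ^ L ≤ (K + L) * (B + 1) ^ (K + L) := by
    intro K L B
    rw [add_mul]
    gcongr <;> omega
  induction c with
  | skip => exact ⟨1, fun B => one 1 B⟩
  | setN b i e => exact ⟨_, fun B => one _ B⟩
  | setR b i e => exact ⟨_, fun B => one _ B⟩
  | draw b i => exact ⟨_, fun B => one _ B⟩
  | seq c c' ih ih' =>
    obtain ⟨K, hK⟩ := ih
    obtain ⟨L, hL⟩ := ih'
    exact ⟨K + L, fun B => (Nat.add_le_add (hK B) (hL B)).trans (add K L B)⟩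
  | ite e f c c' ih ih' =>
    obtain ⟨K, hK⟩ := ih
    obtain ⟨L, hL⟩ := ih'
    refine ⟨e.steps + f.steps + 1 + K + L, fun B => ?_⟩
    refine le_trans ?_ (add _ L B)
    refine Nat.add_le_add ?_ (hL B)
    refine le_trans ?_ (add _ K B)
    exact Nat.add_le_add (one _ B) (hK B)
  | loop b e c ih =>
    obtain ⟨K, hK⟩ := ih
    refine ⟨e.steps + 1 + (K + 1 + 1), fun B => ?_⟩
    refine le_trans ?_ (add _ _ B)
    refine Nat.add_le_add (one _ B) ?_
    have h1 : 1 + c.timeBound B ≤ (K + 2) * (B + 1) ^ (K + 1) := by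
      have := hK B
      have h2 : (B + 1) ^ K ≤ (B + 1) ^ (K + 1) := Nat.pow_le_pow_right (by omega) (by omega)
      have h3 : 1 ≤ (B + 1) ^ (K + 1) := Nat.one_le_pow _ _ (by omega)
      nlinarith
    calc B * (1 + c.timeBound B) ≤ (B + 1) * ((K + 2) * (B + 1) ^ (K + 1)) := by gcongr; omega
      _ = (K + 1 + 1) * (B + 1) ^ (K + 1 + 1) := by ring

end RealRAM
end

/-! ### The learner as a program. -/

noncomputable section

namespace RealRAM

/-- The integer register at index `0` of the integer array `a`. -/
def NExp.reg (a : ℕ) : NExp := .load a (.const 0)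

/-- The real register at index `0` of the real array `a`. -/
def RExp.reg (a : ℕ) : RExp := .load a (.const 0)

@[simp] theorem NExp.eval_reg (I : Input) (m : Mem) (a : ℕ) :
    (NExp.reg a).eval I m = m.nat a 0 := rfl

@[simp] theorem RExp.eval_reg (I : Input) (m : Mem) (a : ℕ) :
    (RExp.reg a).eval I m = m.real a 0 := rfl

/-- Powers with constant exponents. -/
def RExp.npow (e : RExp) : ℕ → RExp
  | 0 => .const 1
  | k + 1 => .mul (e.npow k) e

@[simp] theorem RExp.eval_npow (I : Input) (m : Mem) (e : RExp) (k : ℕ) :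
    (e.npow k).eval I m = e.eval I m ^ k := by
  induction k with
  | zero => simp [RExp.npow, RExp.eval]
  | succ k ih => simp [RExp.npow, RExp.eval, ih, pow_succ]

/-- The expression `n + 1 / σ`. -/
def RExp.scale : RExp := .add (.cast .size) (.div (.const 1) .sigma)

@[simp] theorem RExp.eval_scale (I : Input) (m : Mem) :
    RExp.scale.eval I m = I.size + 1 / I.sigma := by
  simp [RExp.scale, RExp.eval, NExp.eval]

/-! Array usage. Integer arrays: `0` holds the number of grid points, `1` the current expert, `2` to
`5` are loop counters, and `6` holds the best vertex. Real arrays: `0` holds the action, `1` the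
weights of the experts, `2` the indicator function of the unblocked vertices, `3` the total
performance, `4` the best score, `5` the degree, `6` the score, `7` a sum and `8` a threshold. -/

/-- Whether vertex `u` counts for the degree. -/
def maskExp : GreedyVariant → RExp
  | .nonadaptive => .const 1
  | .adaptive => .load 2 (.reg 4)

/-- Compute the degree of vertex `v`. -/
def degCmd (V : GreedyVariant) : Cmd :=
  .seq (.setR 5 (.const 0) (.const 0))
    (.loop 4 (.cast .size) (.setR 5 (.const 0)
      (.add (.reg 5) (.mul (maskExp V) (.cast (.adj (.reg 3) (.reg 4)))))))

/-- Compute `w_v ^ N / (1 + deg v) ^ i`. -/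
def powCmd : Cmd :=
  .seq (.setR 6 (.const 0) (.const 1))
    (.loop 5 (.cast (.reg 0))
      (.seq (.setR 6 (.const 0) (.mul (.reg 6) (.weight (.reg 3))))
        (.ite (.cast (.reg 5)) (.cast (.reg 1))
          (.setR 6 (.const 0) (.div (.reg 6) (.add (.const 1) (.reg 5)))) .skip)))

/-- Compare vertex `v` with the best vertex so far. -/
def scanCmd (V : GreedyVariant) : Cmd :=
  .seq (degCmd V) (.seq powCmd (.seq
    (.setR 6 (.const 0)
      (.sub (.mul (.load 2 (.reg 3)) (.add (.reg 6) (.const 1))) (.const 1)))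
    (.ite (.reg 4) (.reg 6)
      (.seq (.setR 4 (.const 0) (.reg 6)) (.setN 6 (.const 0) (.reg 3))) .skip)))

/-- Find the best unblocked vertex. -/
def argmaxCmd (V : GreedyVariant) : Cmd :=
  .seq (.setR 4 (.const 0) (.const (-1))) (.seq (.setN 6 (.const 0) .size)
    (.loop 3 (.cast .size) (scanCmd V)))

/-- Block the best vertex and its neighbours. -/
def blockCmd : Cmd :=
  .seq (.loop 4 (.cast .size) (.setR 2 (.reg 4)
      (.mul (.load 2 (.reg 4)) (.sub (.const 1) (.cast (.adj (.reg 6) (.reg 4)))))))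
    (.setR 2 (.reg 6) (.const 0))

/-- One round of the greedy heuristic. -/
def stepCmd (V : GreedyVariant) : Cmd :=
  .seq (argmaxCmd V) (.seq (.setR 3 (.const 0) (.add (.reg 3) (.weight (.reg 6)))) blockCmd)

/-- The greedy heuristic with parameter `i / N`. -/
def greedyCmd (V : GreedyVariant) : Cmd :=
  .seq (.loop 4 (.cast .size) (.setR 2 (.reg 4) (.const 1)))
    (.seq (.setR 3 (.const 0) (.const 0)) (.loop 2 (.cast .size) (stepCmd V)))

/-- Update the weights of all experts. -/
def updateCmd (V : GreedyVariant) (q : ℕ) : Cmd :=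
  .loop 1 (.cast (.reg 0)) (.seq (greedyCmd V)
    (.setR 1 (.reg 1) (.mul (.load 1 (.reg 1))
      (.add (.const 1) (.div (.reg 3) (.mul (RExp.scale.npow q) (.cast .size)))))))

/-- Choose an expert with probability proportional to its weight. -/
def chooseCmd : Cmd :=
  .seq (.setR 7 (.const 0) (.const 0)) (.seq
    (.loop 1 (.cast (.reg 0)) (.setR 7 (.const 0) (.add (.reg 7) (.load 1 (.reg 1))))) (.seq
    (.draw 8 (.const 0)) (.seq
    (.setR 8 (.const 0) (.mul (.reg 8) (.reg 7))) (.seq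
    (.setR 7 (.const 0) (.const 0)) (.seq
    (.setR 0 (.const 0) (.const 0))
    (.loop 1 (.cast (.reg 0)) (.seq
      (.ite (.reg 8) (.reg 7) .skip
        (.setR 0 (.const 0) (.div (.cast (.reg 1)) (.cast (.reg 0)))))
      (.setR 7 (.const 0) (.add (.reg 7) (.load 1 (.reg 1)))))))))))

/-- Store the number `⌈(n + 1 / σ) ^ p⌉₊` of grid points. -/
def gridCmd (p : ℕ) : Cmd :=
  .loop 1 (RExp.scale.npow p) (.setN 0 (.const 0) (.add (.reg 1) (.const 1)))

/-- Set all weights to `1`. -/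
def initCmd : Cmd := .loop 1 (.cast (.reg 0)) (.setR 1 (.reg 1) (.const 1))

/-- Multiplicative weights on `⌈(n + 1 / σ) ^ p⌉₊` grid points with learning rate
`1 / (n + 1 / σ) ^ q`. -/
def hedge (V : GreedyVariant) (p q : ℕ) : Learner where
  start := .seq (gridCmd p) initCmd
  choose := chooseCmd
  update := updateCmd V q

/-! ### Correctness of the simulated heuristic and of the weight updates. -/

variable {U : ℕ → unitInterval} {I : Input}

theorem Cmd.run_seq (c c' : Cmd) (m : Mem) :
    (Cmd.seq c c').run U I m = c'.run U I (c.run U I m) := rfl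

theorem Cmd.run_for {a : ℕ} {e : RExp} {c : Cmd} {m : Mem} (K : ℕ) (he : e.eval I m = K)
    (P : ℕ → Mem → Prop) (h0 : P 0 (m.tick (e.steps + 1)))
    (hs : ∀ k m', k < K → P k m' → P (k + 1) (c.run U I ((m'.storeN a 0 k).tick 1))) :
    P K ((Cmd.loop a e c).run U I m) := by
  have hK : ⌈e.eval I m⌉₊ = K := by rw [he, Nat.ceil_natCast]
  have := Cmd.run_loop_induction (U := U) (I := I) (a := a) (e := e) (c := c) (m := m) P h0
    (by rw [hK]; exact hs)
  rwa [hK] at this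

variable {n : ℕ} {σ : ℝ} {x : MWISInstance n} {V : GreedyVariant}

open Classical in
theorem instanceInput_adj (v u : Fin n) :
    (instanceInput σ x).adj v u = if x.graph.Adj v u then 1 else 0 := by
  simp [instanceInput]

/-- The index `n` serves as a dummy vertex without neighbours and of weight `0`: selecting it when
every vertex is blocked makes the superfluous greedy rounds harmless. -/
theorem instanceInput_adj_size (u : ℕ) : (instanceInput σ x).adj n u = 0 := by
  simp [instanceInput]

theorem instanceInput_weight (v : Fin n) : (instanceInput σ x).weight v = x.weight v := by
  simp [instanceInput]

theorem instanceInput_weight_size : (instanceInput σ x).weight n = 0 := by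
  simp [instanceInput]

/-- `f` is the indicator function of `S`. -/
def IsIndicator (S : Finset (Fin n)) (f : ℕ → ℝ) : Prop :=
  ∀ u : Fin n, f u = if u ∈ S then 1 else 0

theorem run_degCmd {S : Finset (Fin n)} {m : Mem} (hS : IsIndicator S (m.real 2)) (v : Fin n)
    (hv : m.nat 3 0 = v) :
    ((degCmd V).run U (instanceInput σ x) m).real 5 0 = x.deg V S v := by
  classical
  let f : ℕ → ℝ := fun u => match V with
    | .nonadaptive => (instanceInput σ x).adj v u
    | .adaptive => m.real 2 u * (instanceInput σ x).adj v u
  rw [degCmd, Cmd.run_seq]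
  have key := Cmd.run_for (U := U) (I := instanceInput σ x) (a := 4) (e := .cast .size)
    (c := (.setR 5 (.const 0)
      (.add (.reg 5) (.mul (maskExp V) (.cast (.adj (.reg 3) (.reg 4)))))))
    (m := (Cmd.setR 5 (.const 0) (.const 0)).run U (instanceInput σ x) m) n
    (by simp [RExp.eval, NExp.eval, instanceInput])
    (fun k m' => m'.nat 3 0 = v ∧ m'.real 2 = m.real 2 ∧ m'.real 5 0 = ∑ u ∈ Finset.range k, f u)
    ⟨by simp [Cmd.run, hv], by simp [Cmd.run], by simp [Cmd.run, RExp.eval, NExp.eval]⟩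
    (by
      rintro k m' hk ⟨h1, h2, h3⟩
      refine ⟨by simp [Cmd.run, h1], by simp [Cmd.run, h2], ?_⟩
      rw [Finset.sum_range_succ]
      cases V <;> simp [Cmd.run, RExp.eval, NExp.eval, h1, h2, h3, maskExp, f])
  rw [key.2.2, Finset.sum_range]
  cases V <;> simp [f, instanceInput_adj, MWISInstance.deg, hS _, Finset.sum_ite, Finset.filter_inter]

theorem run_powCmd {m : Mem} {N i : ℕ} (hN : m.nat 0 0 = N) (hi : m.nat 1 0 = i) (hiN : i ≤ N)
    (v : Fin n) (hv : m.nat 3 0 = v) :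
    (powCmd.run U (instanceInput σ x) m).real 6 0 = x.weight v ^ N / (1 + m.real 5 0) ^ i := by
  rw [powCmd, Cmd.run_seq]
  have key := Cmd.run_for (U := U) (I := instanceInput σ x) (a := 5) (e := .cast (.reg 0))
    (c := (.seq (.setR 6 (.const 0) (.mul (.reg 6) (.weight (.reg 3))))
        (.ite (.cast (.reg 5)) (.cast (.reg 1))
          (.setR 6 (.const 0) (.div (.reg 6) (.add (.const 1) (.reg 5)))) .skip)))
    (m := (Cmd.setR 6 (.const 0) (.const 1)).run U (instanceInput σ x) m) N
    (by simp [RExp.eval, Cmd.run, hN])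
    -- Every iteration multiplies by the weight, but only the first `i` divide by `1 + deg`.
    (fun k m' => m'.nat 1 0 = i ∧ m'.nat 3 0 = v ∧ m'.real 5 = m.real 5 ∧
      m'.real 6 0 = x.weight v ^ k / (1 + m.real 5 0) ^ (min k i))
    ⟨by simp [Cmd.run, hi], by simp [Cmd.run, hv], by simp [Cmd.run],
      by simp [Cmd.run, RExp.eval, NExp.eval]⟩
    (by
      rintro k m' hk ⟨h1, h2, h3, h4⟩
      by_cases hki : k < i
      · have e1 : min k i = k := by omega
        have e2 : min (k + 1) i = k + 1 := by omega
        simp [Cmd.run, RExp.eval, NExp.eval, h1, h2, h3, h4, hki, e1, instanceInput_weight]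
        rw [pow_succ, pow_succ, div_mul_eq_mul_div, div_div]
      · have e1 : min k i = i := by omega
        have e2 : min (k + 1) i = i := by omega
        simp [Cmd.run, RExp.eval, NExp.eval, h1, h2, h3, h4, hki, e1, e2, instanceInput_weight]
        rw [pow_succ, div_mul_eq_mul_div])
  rw [key.2.2.2, min_eq_right hiN]

/-- The number with which the program compares the vertices. -/
def key (V : GreedyVariant) (N i : ℕ) (x : MWISInstance n) (S : Finset (Fin n)) (j : ℕ) : ℝ :=
  if h : j < n then
    if ⟨j, h⟩ ∈ S then x.weight ⟨j, h⟩ ^ N / (1 + (x.deg V S ⟨j, h⟩ : ℝ)) ^ i else -1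
  else -1

theorem run_scanCmd {m : Mem} {N i : ℕ} (hN : m.nat 0 0 = N) (hi : m.nat 1 0 = i) (hiN : i ≤ N)
    {S : Finset (Fin n)} (hS : IsIndicator S (m.real 2)) {k : ℕ} (hk : k < n)
    (hv : m.nat 3 0 = k) :
    let m' := (scanCmd V).run U (instanceInput σ x) m
    (m'.real 4 0 = if m.real 4 0 < key V N i x S k then key V N i x S k else m.real 4 0) ∧
      m'.nat 6 0 = if m.real 4 0 < key V N i x S k then k else m.nat 6 0 := by
  intro m'
  have hd := run_degCmd (U := U) (σ := σ) (x := x) (V := V) hS ⟨k, hk⟩ hv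
  set m1 := (degCmd V).run U (instanceInput σ x) m with hm1
  have n1 : ∀ a, (degCmd V).writesNat a = false → m1.nat a = m.nat a :=
    fun a h => Cmd.run_nat h m
  have r1 : ∀ a, (degCmd V).writesReal a = false → m1.real a = m.real a :=
    fun a h => Cmd.run_real h m
  have hp := run_powCmd (U := U) (σ := σ) (x := x) (m := m1) (N := N) (i := i)
    (by rw [n1 0 rfl, hN]) (by rw [n1 1 rfl, hi]) hiN ⟨k, hk⟩ (by rw [n1 3 rfl, hv])
  rw [hd] at hp
  set m2 := powCmd.run U (instanceInput σ x) m1 with hm2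
  have n2 : ∀ a, (degCmd V).writesNat a = false → powCmd.writesNat a = false →
      m2.nat a = m.nat a := fun a h h' => (Cmd.run_nat h' m1).trans (n1 a h)
  have r2 : ∀ a, (degCmd V).writesReal a = false → powCmd.writesReal a = false →
      m2.real a = m.real a := fun a h h' => (Cmd.run_real h' m1).trans (r1 a h)
  have e3 := n2 3 rfl rfl
  have e6 := n2 6 rfl rfl
  have e2 := r2 2 rfl rfl
  have e4 := r2 4 rfl rfl
  -- With the indicator as factor, `1 * (s + 1) - 1 = s` for an unblocked vertex and `0 * (s + 1) -
  -- 1 = -1` for a blocked one, below every genuine key.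
  have hval : m2.real 2 k * (m2.real 6 0 + 1) - 1 = key V N i x S k := by
    have := hS ⟨k, hk⟩
    simp only at this
    rw [e2, this, hp, key, dif_pos hk]
    split_ifs <;> simp
  have hm' : m' = Cmd.run U (instanceInput σ x) (.seq
    (.setR 6 (.const 0)
      (.sub (.mul (.load 2 (.reg 3)) (.add (.reg 6) (.const 1))) (.const 1)))
    (.ite (.reg 4) (.reg 6)
      (.seq (.setR 4 (.const 0) (.reg 6)) (.setN 6 (.const 0) (.reg 3))) .skip)) m2 := rfl
  rw [hm']
  by_cases h : m.real 4 0 < key V N i x S k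
  · simp [Cmd.run, RExp.eval, NExp.eval, hval, h, e4, e3, hv]
  · simp [Cmd.run, RExp.eval, NExp.eval, hval, h, e4, e3, hv, e6]

/-- On `S` the key is the `N`-th power of the score at `i / N`, and `N`-th powers are monotone on
nonnegative numbers. -/
theorem key_le_iff {N i : ℕ} (hN : N ≠ 0) {S : Finset (Fin n)} (hx : ∀ v, 0 ≤ x.weight v)
    {u v : Fin n} (hu : u ∈ S) (hv : v ∈ S) :
    key V N i x S u ≤ key V N i x S v ↔
      x.score V ((i : ℝ) / N) S u ≤ x.score V ((i : ℝ) / N) S v := by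
  have h : ∀ v ∈ S, key V N i x S v = x.score V ((i : ℝ) / N) S v ^ N := by
    intro v hv
    have h0 : (0 : ℝ) ≤ 1 + (x.deg V S v : ℝ) := by positivity
    simp only [key, v.2, dif_pos, Fin.eta, hv, if_true, MWISInstance.score, div_pow]
    rw [← Real.rpow_natCast ((1 + (x.deg V S v : ℝ)) ^ ((i : ℝ) / N)), ← Real.rpow_mul h0,
      div_mul_cancel₀ _ (by exact_mod_cast hN), Real.rpow_natCast]
  have h0 : ∀ v, 0 ≤ x.score V ((i : ℝ) / N) S v := fun v =>
    div_nonneg (hx v) (Real.rpow_nonneg (by positivity) _)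
  rw [h u hu, h v hv, pow_le_pow_iff_left₀ (h0 u) (h0 v) hN]

theorem key_nonneg {N i : ℕ} {S : Finset (Fin n)} (hx : ∀ v, 0 ≤ x.weight v)
    {v : Fin n} (hv : v ∈ S) : 0 ≤ key V N i x S v := by
  simp only [key, v.2, dif_pos, Fin.eta, hv, if_true]
  exact div_nonneg (pow_nonneg (hx v) _) (by positivity)

theorem key_eq_neg_one {N i : ℕ} {S : Finset (Fin n)} {j : ℕ}
    (h : ∀ v : Fin n, v.1 = j → v ∉ S) : key V N i x S j = -1 := by
  unfold key
  split_ifs with h1 h2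
  · exact absurd h2 (h _ rfl)
  · rfl
  · rfl

theorem run_argmaxCmd {m : Mem} {N i : ℕ} (hN0 : N ≠ 0) (hN : m.nat 0 0 = N) (hi : m.nat 1 0 = i)
    (hiN : i ≤ N) (hx : ∀ v, 0 ≤ x.weight v) {S : Finset (Fin n)}
    (hS : IsIndicator S (m.real 2)) :
    let m' := (argmaxCmd V).run U (instanceInput σ x) m
    (∀ h : (x.best V ((i : ℝ) / N) S).Nonempty,
      m'.nat 6 0 = (x.best V ((i : ℝ) / N) S).min' h) ∧
    (¬ (x.best V ((i : ℝ) / N) S).Nonempty → m'.nat 6 0 = n) := by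
  intro m'
  set q := key V N i x S with hq
  have hloop := Cmd.run_for (U := U) (I := instanceInput σ x) (a := 3) (e := .cast .size)
    (c := scanCmd V)
    (m := (Cmd.seq (.setR 4 (.const 0) (.const (-1))) (.setN 6 (.const 0) .size)).run U
      (instanceInput σ x) m) n
    (by simp [RExp.eval, NExp.eval, instanceInput])
    -- Either no unblocked vertex has been met and the initial values `n` and `-1` remain, or the
    -- stored vertex is the first maximizer among those scanned. The last clause is strict because
    -- the program replaces it only by a strictly larger key; this is the tie-breaking rule.
    (fun k m' => m'.nat 0 = m.nat 0 ∧ m'.nat 1 = m.nat 1 ∧ m'.real 2 = m.real 2 ∧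
      ((m'.nat 6 0 = n ∧ m'.real 4 0 = -1 ∧ ∀ j < k, q j ≤ -1) ∨
        (m'.nat 6 0 < k ∧ m'.real 4 0 = q (m'.nat 6 0) ∧ -1 < q (m'.nat 6 0) ∧
          (∀ j < k, q j ≤ q (m'.nat 6 0)) ∧ ∀ j < m'.nat 6 0, q j < q (m'.nat 6 0))))
    ⟨by simp [Cmd.run], by simp [Cmd.run], by simp [Cmd.run], Or.inl
      (by simp [Cmd.run, RExp.eval, NExp.eval, instanceInput])⟩
    (by
      rintro k m' hk ⟨h0, h1, h2, h3⟩
      set m1 := ((m'.storeN 3 0 k).tick 1) with hm1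
      have hs := run_scanCmd (U := U) (σ := σ) (x := x) (V := V) (m := m1) (N := N) (i := i)
        (S := S) (by simp [hm1, h0, hN]) (by simp [hm1, h1, hi]) hiN (by simpa [hm1, h2] using hS)
        hk (by simp [hm1])
      have a4 : m1.real 4 0 = m'.real 4 0 := rfl
      have a6 : m1.nat 6 0 = m'.nat 6 0 := by simp [hm1]
      rw [a4, a6] at hs
      refine ⟨?_, ?_, ?_, ?_⟩
      · rw [Cmd.run_nat rfl]; simp [hm1, h0]
      · rw [Cmd.run_nat rfl]; simp [hm1, h1]
      · rw [Cmd.run_real rfl]; simp [hm1, h2]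
      generalize (scanCmd V).run U (instanceInput σ x) m1 = m2 at hs ⊢
      obtain ⟨s1, s2⟩ := hs
      rcases h3 with ⟨b1, b2, b3⟩ | ⟨b1, b2, b3, b4, b5⟩
      · rw [b2] at s1 s2
        by_cases h : -1 < q k
        · rw [if_pos h] at s1 s2
          right
          rw [s2, s1]
          refine ⟨by omega, rfl, h, ?_, ?_⟩
          · intro j hj
            rcases Nat.lt_succ_iff_lt_or_eq.1 hj with hj | rfl
            · exact (b3 j hj).trans h.le
            · exact le_rfl
          · exact fun j hj => (b3 j hj).trans_lt h
        · rw [if_neg h] at s1 s2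
          left
          refine ⟨s2.trans b1, s1, ?_⟩
          intro j hj
          rcases Nat.lt_succ_iff_lt_or_eq.1 hj with hj | rfl
          · exact b3 j hj
          · exact not_lt.1 h
      · rw [b2] at s1 s2
        right
        by_cases h : q (m'.nat 6 0) < q k
        · rw [if_pos h] at s1 s2
          rw [s2, s1]
          refine ⟨by omega, rfl, b3.trans h, ?_, ?_⟩
          · intro j hj
            rcases Nat.lt_succ_iff_lt_or_eq.1 hj with hj | rfl
            · exact (b4 j hj).trans h.le
            · exact le_rfl
          · exact fun j hj => (b4 j hj).trans_lt h
        · rw [if_neg h] at s1 s2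
          rw [s2, s1]
          refine ⟨by omega, rfl, b3, ?_, b5⟩
          intro j hj
          rcases Nat.lt_succ_iff_lt_or_eq.1 hj with hj | rfl
          · exact b4 j hj
          · exact not_lt.1 h)
  have hm' : m' = (Cmd.loop 3 (.cast .size) (scanCmd V)).run U (instanceInput σ x)
      ((Cmd.seq (.setR 4 (.const 0) (.const (-1))) (.setN 6 (.const 0) .size)).run U
      (instanceInput σ x) m) := rfl
  rw [← hm'] at hloop
  have hbest : ∀ v, v ∈ x.best V ((i : ℝ) / N) S ↔ v ∈ S ∧ ∀ u ∈ S, q u ≤ q v := by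
    intro v
    simp only [MWISInstance.best, Finset.mem_filter]
    refine and_congr_right fun hv => forall₂_congr fun u hu => ?_
    rw [hq, key_le_iff hN0 hx hu hv]
  rcases hloop.2.2.2 with ⟨b1, -, b3⟩ | ⟨b1, -, b3, b4, b5⟩
  · refine ⟨fun h => ?_, fun _ => b1⟩
    obtain ⟨v, hv⟩ := h
    have h1 := b3 v v.2
    have h2 := key_nonneg (V := V) (N := N) (i := i) hx ((hbest v).1 hv).1
    linarith
  · set b : Fin n := ⟨m'.nat 6 0, b1⟩ with hb
    have hbS : b ∈ S := by
      by_contra hbS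
      have := key_eq_neg_one (V := V) (N := N) (i := i) (x := x) (S := S) (j := m'.nat 6 0)
        (fun v hv => by rwa [show v = b from Fin.ext hv])
      rw [hq, this] at b3
      exact lt_irrefl _ b3
    have hbB : b ∈ x.best V ((i : ℝ) / N) S := (hbest b).2 ⟨hbS, fun u _ => b4 u u.2⟩
    refine ⟨fun h => ?_, fun h => absurd ⟨b, hbB⟩ h⟩
    have : (x.best V ((i : ℝ) / N) S).min' h = b := by
      apply le_antisymm (Finset.min'_le _ _ hbB)
      refine Finset.le_min' _ _ _ fun v hv => ?_
      by_contra hlt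
      exact absurd (((hbest v).1 hv).2 b hbS) (not_le.2 (b5 v (not_le.1 hlt)))
    rw [this]

theorem run_blockCmd_size {m : Mem} {S : Finset (Fin n)} (hS : IsIndicator S (m.real 2))
    (h6 : m.nat 6 0 = n) : IsIndicator S ((blockCmd.run U (instanceInput σ x) m).real 2) := by
  rw [blockCmd, Cmd.run_seq]
  have key := Cmd.run_for (U := U) (I := instanceInput σ x) (a := 4) (e := .cast .size)
    (c := (.setR 2 (.reg 4)
      (.mul (.load 2 (.reg 4)) (.sub (.const 1) (.cast (.adj (.reg 6) (.reg 4)))))))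
    (m := m) n (by simp [RExp.eval, NExp.eval, instanceInput])
    (fun k m' => m'.nat 6 0 = n ∧ m'.real 2 = m.real 2) ⟨h6, rfl⟩
    (by
      rintro k m' hk ⟨h1, h2⟩
      simp [Cmd.run, RExp.eval, NExp.eval, h1, h2, instanceInput_adj_size])
  generalize (Cmd.loop 4 (.cast .size) (.setR 2 (.reg 4)
    (.mul (.load 2 (.reg 4)) (.sub (.const 1) (.cast (.adj (.reg 6) (.reg 4))))))).run U
    (instanceInput σ x) m = m1 at key ⊢
  intro u
  have hu : u.1 ≠ n := u.2.ne
  simp [Cmd.run, key.1, key.2, hu, hS u]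

theorem run_blockCmd {m : Mem} {S : Finset (Fin n)} (hS : IsIndicator S (m.real 2)) (v : Fin n)
    (h6 : m.nat 6 0 = v) (S' : Finset (Fin n))
    (hS' : ∀ u, u ∈ S' ↔ u ∈ S ∧ u ≠ v ∧ ¬ x.graph.Adj v u) :
    IsIndicator S' ((blockCmd.run U (instanceInput σ x) m).real 2) := by
  classical
  rw [blockCmd, Cmd.run_seq]
  have key := Cmd.run_for (U := U) (I := instanceInput σ x) (a := 4) (e := .cast .size)
    (c := (.setR 2 (.reg 4)
      (.mul (.load 2 (.reg 4)) (.sub (.const 1) (.cast (.adj (.reg 6) (.reg 4)))))))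
    (m := m) n (by simp [RExp.eval, NExp.eval, instanceInput])
    (fun k m' => m'.nat 6 0 = v ∧ ∀ u : Fin n, m'.real 2 u =
      if u ∈ S ∧ (u.1 < k → ¬ x.graph.Adj v u) then 1 else 0)
    ⟨h6, fun u => by simpa using hS u⟩
    (by
      rintro k m' hk ⟨h1, h2⟩
      refine ⟨by simp [Cmd.run, h1], fun u => ?_⟩
      by_cases hu : u.1 = k
      · have h3 := h2 u
        have h4 := instanceInput_adj (σ := σ) (x := x) v u
        rw [hu] at h3 h4
        simp only [Cmd.run, RExp.eval, NExp.eval, NExp.eval_reg, Mem.storeN_nat, Mem.tick_nat,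
          Mem.tick_real, Mem.storeR_real, Mem.storeN_real, Function.update_self, hu,
          Function.update_of_ne (show (6 : ℕ) ≠ 4 by norm_num), h1, h3, h4]
        by_cases ha : x.graph.Adj v u <;> simp [ha]
      · have h3 := h2 u
        have h4 : u.1 < k + 1 ↔ u.1 < k := by omega
        simp only [Cmd.run, NExp.eval_reg, Mem.storeN_nat, Mem.tick_nat,
          Mem.tick_real, Mem.storeR_real, Mem.storeN_real, Function.update_self, h4,
          Function.update_of_ne hu, h3])
  generalize (Cmd.loop 4 (.cast .size) (.setR 2 (.reg 4)
    (.mul (.load 2 (.reg 4)) (.sub (.const 1) (.cast (.adj (.reg 6) (.reg 4))))))).run U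
    (instanceInput σ x) m = m1 at key ⊢
  intro u
  by_cases hu : u = v
  · subst hu
    simp [Cmd.run, RExp.eval, key.1, hS']
  · have hu' : u.1 ≠ v.1 := fun h => hu (Fin.ext h)
    simp [Cmd.run, key.1, key.2, hu, hu', hS']

theorem greedy_subset (ρ : ℝ) (k : ℕ) (S : Finset (Fin n)) : x.greedy V ρ k S ⊆ S := by
  classical
  induction k generalizing S with
  | zero => simp [MWISInstance.greedy]
  | succ k ih =>
    rw [MWISInstance.greedy]
    split_ifs with h
    · refine Finset.insert_subset ?_ ((ih _).trans (Finset.filter_subset _ _))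
      exact Finset.filter_subset _ _ (Finset.min'_mem _ h)
    · exact Finset.empty_subset _

/-- Collected weight plus the value still obtainable is conserved, with one round fewer to go. This
form also covers the case in which no vertex is left, where `S' = S` works. -/
theorem run_stepCmd {m : Mem} {N i : ℕ} (hN0 : N ≠ 0) (hN : m.nat 0 0 = N) (hi : m.nat 1 0 = i)
    (hiN : i ≤ N) (hx : ∀ v, 0 ≤ x.weight v) {S : Finset (Fin n)}
    (hS : IsIndicator S (m.real 2)) :
    let m' := (stepCmd V).run U (instanceInput σ x) m
    ∃ S', IsIndicator S' (m'.real 2) ∧ ∀ k,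
      m'.real 3 0 + ∑ v ∈ x.greedy V ((i : ℝ) / N) k S', x.weight v =
        m.real 3 0 + ∑ v ∈ x.greedy V ((i : ℝ) / N) (k + 1) S, x.weight v := by
  classical
  intro m'
  have ha := run_argmaxCmd (U := U) (σ := σ) (V := V) hN0 hN hi hiN hx hS
  set m1 := (argmaxCmd V).run U (instanceInput σ x) m with hm1
  have e2 : m1.real 2 = m.real 2 := Cmd.run_real rfl m
  have e3 : m1.real 3 = m.real 3 := Cmd.run_real rfl m
  set m2 := (Cmd.setR 3 (.const 0) (.add (.reg 3) (.weight (.reg 6)))).run U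
    (instanceInput σ x) m1 with hm2
  have f2 : m2.real 2 = m.real 2 := by rw [← e2]; simp [hm2, Cmd.run]
  have f6 : m2.nat 6 0 = m1.nat 6 0 := by simp [hm2, Cmd.run]
  have f3 : m2.real 3 0 = m.real 3 0 + (instanceInput σ x).weight (m1.nat 6 0) := by
    simp [hm2, Cmd.run, RExp.eval, NExp.eval, e3]
  have hm' : m' = blockCmd.run U (instanceInput σ x) m2 := rfl
  have g3 : m'.real 3 = m2.real 3 := by rw [hm']; exact Cmd.run_real rfl m2
  by_cases h : (x.best V ((i : ℝ) / N) S).Nonempty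
  · have h6 := ha.1 h
    set v := (x.best V ((i : ℝ) / N) S).min' h with hv
    refine ⟨S.filter fun u => u ≠ v ∧ ¬ x.graph.Adj v u, ?_, fun k => ?_⟩
    · rw [hm']
      exact run_blockCmd (by rwa [f2]) v (f6.trans h6) _ (by simp)
    · rw [MWISInstance.greedy, dif_pos h, Finset.sum_insert, g3, f3, h6, instanceInput_weight,
        add_assoc]
      · intro hmem
        have := greedy_subset _ _ _ hmem
        simp at this
  · have h6 := ha.2 h
    refine ⟨S, ?_, fun k => ?_⟩
    · rw [hm']
      exact run_blockCmd_size (by rwa [f2]) (f6.trans h6)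
    · have h1 : ∀ k, x.greedy V ((i : ℝ) / N) k S = ∅ := by
        intro k
        cases k with
        | zero => rfl
        | succ k => rw [MWISInstance.greedy, dif_neg h]
      rw [h1, h1, g3, f3, h6, instanceInput_weight_size, add_zero]

theorem run_greedyCmd {m : Mem} {N i : ℕ} (hN0 : N ≠ 0) (hN : m.nat 0 0 = N) (hi : m.nat 1 0 = i)
    (hiN : i ≤ N) (hx : ∀ v, 0 ≤ x.weight v) :
    ((greedyCmd V).run U (instanceInput σ x) m).real 3 0 = x.cost V ((i : ℝ) / N) := by
  have h1 := Cmd.run_for (U := U) (I := instanceInput σ x) (a := 4) (e := .cast .size)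
    (c := .setR 2 (.reg 4) (.const 1)) (m := m) n (by simp [RExp.eval, NExp.eval, instanceInput])
    (fun k m' => ∀ u < k, m'.real 2 u = 1) (by simp)
    (by
      rintro k m' hk h u hu
      by_cases huk : u = k
      · simp [Cmd.run, RExp.eval, huk]
      · simp [Cmd.run, huk, h u (by omega)])
  have n1 : ∀ a, (Cmd.loop 4 (.cast .size) (.setR 2 (.reg 4) (.const 1))).writesNat a = false →
    ((Cmd.loop 4 (.cast .size) (.setR 2 (.reg 4) (.const 1))).run U (instanceInput σ x) m).nat a =
      m.nat a := fun a h => Cmd.run_nat h m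
  rw [greedyCmd, Cmd.run_seq, Cmd.run_seq]
  set m1 := (Cmd.loop 4 (.cast .size) (.setR 2 (.reg 4) (.const 1))).run U (instanceInput σ x) m
  have h0 := n1 0 rfl
  have h1' := n1 1 rfl
  have key := Cmd.run_for (U := U) (I := instanceInput σ x) (a := 2) (e := .cast .size)
    (c := stepCmd V) (m := (Cmd.setR 3 (.const 0) (.const 0)).run U (instanceInput σ x) m1) n
    (by simp [RExp.eval, NExp.eval, instanceInput])
    (fun k m' => m'.nat 0 0 = N ∧ m'.nat 1 0 = i ∧ ∃ S : Finset (Fin n),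
      IsIndicator S (m'.real 2) ∧
      m'.real 3 0 + ∑ v ∈ x.greedy V ((i : ℝ) / N) (n - k) S, x.weight v =
        x.cost V ((i : ℝ) / N))
    ⟨by simp [Cmd.run, h0, hN], by simp [Cmd.run, h1', hi], Finset.univ,
      fun u => by simp [Cmd.run, h1 u u.2],
      by simp [Cmd.run, RExp.eval, NExp.eval, MWISInstance.cost, MWISInstance.output]⟩
    (by
      rintro k m' hk ⟨g0, g1, S, hS, hc⟩
      obtain ⟨S', hS', hc'⟩ := run_stepCmd (U := U) (σ := σ) (x := x) (V := V)
        (m := (m'.storeN 2 0 k).tick 1) (i := i) hN0 (by simp [g0]) (by simp [g1]) hiN hx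
        (S := S) (by simpa using hS)
      refine ⟨?_, ?_, S', hS', ?_⟩
      · rw [Cmd.run_nat rfl]; simp [g0]
      · rw [Cmd.run_nat rfl]; simp [g1]
      · rw [hc', ← hc, show n - (k + 1) + 1 = n - k by omega]
        rfl)
  obtain ⟨-, -, S, -, h⟩ := key
  simpa [MWISInstance.greedy] using h

/-- The weights of the experts are multiplied by `1 + ε * cost / n`. -/
theorem run_updateCmd {m : Mem} {N q : ℕ} (hN : m.nat 0 0 = N)
    (hx : ∀ v, 0 ≤ x.weight v) :
    ∀ i < N, ((updateCmd V q).run U (instanceInput σ x) m).real 1 i =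
      m.real 1 i * (1 + x.cost V ((i : ℝ) / N) / (((n : ℝ) + 1 / σ) ^ q * n)) := by
  have key := Cmd.run_for (U := U) (I := instanceInput σ x) (a := 1) (e := .cast (.reg 0))
    (c := (.seq (greedyCmd V)
    (.setR 1 (.reg 1) (.mul (.load 1 (.reg 1))
      (.add (.const 1) (.div (.reg 3) (.mul (RExp.scale.npow q) (.cast .size))))))))
    (m := m) N (by simp [RExp.eval, hN])
    (fun k m' => m'.nat 0 0 = N ∧ ∀ i, m'.real 1 i = if i < k then
      m.real 1 i * (1 + x.cost V ((i : ℝ) / N) / (((n : ℝ) + 1 / σ) ^ q * n)) else m.real 1 i)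
    ⟨hN, by simp⟩
    (by
      rintro k m' hk ⟨g0, g1⟩
      have hg := run_greedyCmd (U := U) (σ := σ) (x := x) (V := V)
        (m := (m'.storeN 1 0 k).tick 1) (i := k) (N := N) (by omega) (by simp [g0]) (by simp)
        hk.le hx
      rw [Cmd.run]
      have e0 : ((greedyCmd V).run U (instanceInput σ x) ((m'.storeN 1 0 k).tick 1)).nat 0 0 = N := by
        rw [Cmd.run_nat rfl]; simp [g0]
      have e1 : ((greedyCmd V).run U (instanceInput σ x) ((m'.storeN 1 0 k).tick 1)).nat 1 0 = k := by
        rw [Cmd.run_nat rfl]; simp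
      have e2 : ((greedyCmd V).run U (instanceInput σ x) ((m'.storeN 1 0 k).tick 1)).real 1 =
        m'.real 1 := Cmd.run_real rfl _
      generalize (greedyCmd V).run U (instanceInput σ x) ((m'.storeN 1 0 k).tick 1) = m2 at *
      refine ⟨by simp [Cmd.run, e0], fun i => ?_⟩
      by_cases hik : i = k
      · subst hik
        simp [Cmd.run, RExp.eval, NExp.eval, e1, e2, hg, g1, instanceInput]
      · have h4 : i < k + 1 ↔ i < k := by omega
        simp [Cmd.run, e1, e2, hik, h4, g1])
  intro i hi
  rw [updateCmd, key.2, if_pos hi]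

/-- The largest index `k` whose partial sum `∑ j < k, W j` is at most `τ`, among those below `N`. -/
def pick (W : ℕ → ℝ) (τ : ℝ) : ℕ → ℕ
  | 0 => 0
  | k + 1 => if τ < ∑ j ∈ Finset.range k, W j then pick W τ k else k

theorem run_chooseCmd {m : Mem} {N : ℕ} (hN : m.nat 0 0 = N) :
    (chooseCmd.run U I m).real 0 0 =
        (pick (m.real 1) (U m.draws * ∑ j ∈ Finset.range N, m.real 1 j) N : ℝ) / N ∧
      (chooseCmd.run U I m).draws = m.draws + 1 := by
  have key1 := Cmd.run_for (U := U) (I := I) (a := 1) (e := .cast (.reg 0))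
    (c := .setR 7 (.const 0) (.add (.reg 7) (.load 1 (.reg 1))))
    (m := (Cmd.setR 7 (.const 0) (.const 0)).run U I m) N (by simp [RExp.eval, Cmd.run, hN])
    (fun k m' => m'.nat 0 0 = N ∧ m'.real 1 = m.real 1 ∧ m'.draws = m.draws ∧
      m'.real 7 0 = ∑ j ∈ Finset.range k, m.real 1 j)
    (by simp [Cmd.run, NExp.eval, RExp.eval, hN])
    (by
      rintro k m' hk ⟨g0, g1, g2, g3⟩
      simp [Cmd.run, NExp.eval, RExp.eval, g0, g1, g2, g3, Finset.sum_range_succ])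
  rw [chooseCmd, Cmd.run_seq, Cmd.run_seq, Cmd.run_seq, Cmd.run_seq, Cmd.run_seq, Cmd.run_seq]
  generalize (Cmd.loop 1 (.cast (.reg 0)) (.setR 7 (.const 0) (.add (.reg 7)
    (.load 1 (.reg 1))))).run U I ((Cmd.setR 7 (.const 0) (.const 0)).run U I m) = m1 at *
  obtain ⟨g0, g1, g2, g3⟩ := key1
  set S := ∑ j ∈ Finset.range N, m.real 1 j with hS
  have key2 := Cmd.run_for (U := U) (I := I) (a := 1) (e := .cast (.reg 0))
    (c := (.seq
      (.ite (.reg 8) (.reg 7) .skip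
        (.setR 0 (.const 0) (.div (.cast (.reg 1)) (.cast (.reg 0)))))
      (.setR 7 (.const 0) (.add (.reg 7) (.load 1 (.reg 1))))))
    (m := (Cmd.setR 0 (.const 0) (.const 0)).run U I ((Cmd.setR 7 (.const 0) (.const 0)).run U I
      ((Cmd.setR 8 (.const 0) (.mul (.reg 8) (.reg 7))).run U I
      ((Cmd.draw 8 (.const 0)).run U I m1)))) N
    (by simp [RExp.eval, Cmd.run, g0])
    (fun k m' => m'.nat 0 0 = N ∧ m'.real 1 = m.real 1 ∧ m'.draws = m.draws + 1 ∧
      m'.real 8 0 = U m.draws * S ∧ m'.real 7 0 = ∑ j ∈ Finset.range k, m.real 1 j ∧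
      m'.real 0 0 = (pick (m.real 1) (U m.draws * S) k : ℝ) / N)
    (by simp [Cmd.run, NExp.eval, RExp.eval, g0, g1, g2, g3, pick])
    (by
      rintro k m' hk ⟨g0, g1, g2, g3, g4, g5⟩
      by_cases h : U m.draws * S < ∑ j ∈ Finset.range k, m.real 1 j
      · simp [Cmd.run, NExp.eval, RExp.eval, g0, g1, g2, g3, g4, g5, pick, h,
          Finset.sum_range_succ]
      · simp [Cmd.run, NExp.eval, RExp.eval, g0, g1, g2, g3, g4, pick, h,
          Finset.sum_range_succ])
  exact ⟨key2.2.2.2.2.2, key2.2.2.1⟩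

end RealRAM
end

/-! ### Multiplicative weights and sampling an expert. -/

noncomputable section

/-- The logarithm of the total weight `S T` is squeezed: `log x ≤ x - 1` bounds it above by `log N`
plus `ε` times the mean gain, and `1 - x⁻¹ ≤ log x`, applied to the single weight `W T i ≤ S T`,
bounds it below by the gain of expert `i` up to `ε ^ 2` per round. -/
theorem hedge_regret_le {N : ℕ} {ε : ℝ} (hε : 0 < ε) {g W : ℕ → ℕ → ℝ}
    (hg : ∀ t i, i < N → g t i ∈ Icc (0 : ℝ) 1)
    (hW0 : ∀ i < N, W 0 i = 1) (hW : ∀ t, ∀ i < N, W (t + 1) i = W t i * (1 + ε * g t i))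
    (T : ℕ) {i : ℕ} (hi : i < N) :
    ∑ t ∈ Finset.range T, g t i ≤
      ∑ t ∈ Finset.range T, ∑ j ∈ Finset.range N, g t j * (W t j /
        ∑ l ∈ Finset.range N, W t l) + ε * T + N / ε := by
  set S : ℕ → ℝ := fun t => ∑ l ∈ Finset.range N, W t l with hS
  set G : ℕ → ℝ := fun t => ∑ j ∈ Finset.range N, g t j * (W t j / S t) with hG
  have hpos : ∀ t, ∀ j < N, 0 < W t j := by
    intro t j hj
    induction t with
    | zero => rw [hW0 j hj]; exact one_pos
    | succ t ih =>
      rw [hW t j hj]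
      have := (hg t j hj).1
      positivity
  have hSpos : ∀ t, 0 < S t := fun t =>
    Finset.sum_pos (fun j hj => hpos t j (Finset.mem_range.1 hj)) ⟨i, Finset.mem_range.2 hi⟩
  have hSG : ∀ t, S (t + 1) = S t * (1 + ε * G t) := by
    intro t
    have h1 : S t * G t = ∑ j ∈ Finset.range N, g t j * W t j := by
      rw [hG, Finset.mul_sum]
      refine Finset.sum_congr rfl fun j _ => ?_
      have := (hSpos t).ne'
      field_simp
    calc S (t + 1) = ∑ j ∈ Finset.range N, (W t j + ε * (g t j * W t j)) :=
          Finset.sum_congr rfl fun j hj => by rw [hW t j (Finset.mem_range.1 hj)]; ring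
      _ = S t + ε * (S t * G t) := by rw [Finset.sum_add_distrib, ← Finset.mul_sum, h1]
      _ = _ := by ring
  have hG0 : ∀ t, 0 ≤ G t := fun t => Finset.sum_nonneg fun j hj =>
    mul_nonneg (hg t j (Finset.mem_range.1 hj)).1
      (div_nonneg (hpos t j (Finset.mem_range.1 hj)).le (hSpos t).le)
  have hup : Real.log (S T) ≤ Real.log N + ε * ∑ t ∈ Finset.range T, G t := by
    induction T with
    | zero =>
      have : S 0 = N := by
        rw [hS]
        simp only
        rw [Finset.sum_congr rfl fun j hj => hW0 j (Finset.mem_range.1 hj)]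
        simp
      simp [this]
    | succ T ih =>
      have h1 : 0 < 1 + ε * G T := by have := hG0 T; positivity
      rw [hSG, Real.log_mul (hSpos T).ne' h1.ne', Finset.sum_range_succ, mul_add]
      have := Real.log_le_sub_one_of_pos h1
      linarith
  have hlow : ∑ t ∈ Finset.range T, (ε * g t i - ε ^ 2) ≤ Real.log (W T i) := by
    clear hup
    induction T with
    | zero => simp [hW0 i hi]
    | succ T ih =>
      obtain ⟨g0, g1⟩ := hg T i hi
      have h1 : 0 < 1 + ε * g T i := by positivity
      rw [hW T i hi, Real.log_mul (hpos T i hi).ne' h1.ne', Finset.sum_range_succ]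
      have h2 := Real.one_sub_inv_le_log_of_pos h1
      have h3 : ε * g T i - ε ^ 2 ≤ 1 - (1 + ε * g T i)⁻¹ := by
        have h4 : 1 - (1 + ε * g T i)⁻¹ = ε * g T i - (ε * g T i) ^ 2 / (1 + ε * g T i) := by
          field_simp
          ring
        rw [h4]
        have h5 : (ε * g T i) ^ 2 / (1 + ε * g T i) ≤ ε ^ 2 := by
          rw [div_le_iff₀ h1]
          have h6 : (g T i) ^ 2 ≤ 1 := pow_le_one₀ g0 g1
          have h7 : 0 ≤ ε ^ 2 * (ε * g T i) := by positivity
          have h8 : ε ^ 2 * g T i ^ 2 ≤ ε ^ 2 * 1 := by gcongr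
          rw [mul_pow]
          linarith
        linarith
      linarith
  have hle : Real.log (W T i) ≤ Real.log (S T) :=
    Real.log_le_log (hpos T i hi) (Finset.single_le_sum
      (f := fun l => W T l) (fun j hj => (hpos T j (Finset.mem_range.1 hj)).le)
      (Finset.mem_range.2 hi))
  -- A crude bound is enough, as `T` may be required to exceed a polynomial in `N`.
  have hN : Real.log N ≤ N := Real.log_le_self (Nat.cast_nonneg N)
  rw [Finset.sum_sub_distrib, ← Finset.mul_sum, Finset.sum_const, Finset.card_range,
    nsmul_eq_mul] at hlow
  have h := (hlow.trans hle).trans (hup.trans (add_le_add_left hN _))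
  have h2 : ∑ t ∈ Finset.range T, g t i =
      (ε * ∑ t ∈ Finset.range T, g t i - T * ε ^ 2) / ε + ε * T := by
    field_simp
    ring
  have h3 : (N + ε * ∑ t ∈ Finset.range T, G t) / ε = N / ε + ∑ t ∈ Finset.range T, G t := by
    field_simp
  rw [h2]
  have := div_le_div_of_nonneg_right h hε.le
  rw [h3] at this
  linarith

namespace RealRAM

theorem pick_congr {W W' : ℕ → ℝ} {τ : ℝ} {N : ℕ} (h : ∀ i < N, W i = W' i) :
    pick W τ N = pick W' τ N := by
  induction N with
  | zero => rfl
  | succ N ih =>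
    rw [pick, pick, ih fun i hi => h i (by omega),
      Finset.sum_congr rfl fun i hi => h i (by have := Finset.mem_range.1 hi; omega)]

theorem pick_lt (W : ℕ → ℝ) (τ : ℝ) {N : ℕ} (hN : N ≠ 0) : pick W τ N < N := by
  induction N with
  | zero => exact absurd rfl hN
  | succ N ih =>
    rw [pick]
    split_ifs
    · rcases Nat.eq_zero_or_pos N with rfl | h
      · simp [pick]
      · exact (ih h.ne').trans (Nat.lt_succ_self N)
    · exact Nat.lt_succ_self N

theorem measurable_pick {Ω : Type*} [MeasurableSpace Ω] {W : Ω → ℕ → ℝ} {τ : Ω → ℝ}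
    (hW : ∀ i, Measurable fun ω => W ω i) (hτ : Measurable τ) (N : ℕ) :
    Measurable fun ω => pick (W ω) (τ ω) N := by
  induction N with
  | zero => exact measurable_const
  | succ N ih =>
    simp only [pick]
    exact Measurable.ite (measurableSet_lt hτ (Finset.measurable_sum _ fun i _ => hW i)) ih
      measurable_const

/-- The index picked with a uniform random threshold is distributed according to the weights. -/
theorem integral_pick {W : ℕ → ℝ} {N : ℕ} (hN : N ≠ 0) (hW : ∀ i < N, 0 < W i) (f : ℕ → ℝ) :
    ∫ u : unitInterval, f (pick W (u * ∑ j ∈ Finset.range N, W j) N) =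
      ∑ j ∈ Finset.range N, f j * (W j / ∑ l ∈ Finset.range N, W l) := by
  set S := ∑ j ∈ Finset.range N, W j with hS
  have hSpos : 0 < S := Finset.sum_pos (fun j hj => hW j (Finset.mem_range.1 hj))
    ⟨0, Finset.mem_range.2 (Nat.pos_of_ne_zero hN)⟩
  have hmeas : ∀ M, Measurable fun u : unitInterval => f (pick W (u * S) M) := fun M =>
    (measurable_from_top (f := f)).comp
      (measurable_pick (W := fun _ => W) (fun _ => measurable_const) (measurable_subtype_coe.mul_const S) M)
  have hint : ∀ M, M ≠ 0 → Integrable fun u : unitInterval => f (pick W (u * S) M) := by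
    intro M hM
    refine Integrable.of_bound (hmeas M).aestronglyMeasurable
      (∑ j ∈ Finset.range M, |f j|) (Filter.Eventually.of_forall fun u => ?_)
    exact Finset.single_le_sum (f := fun j => |f j|) (fun j _ => abs_nonneg _)
      (Finset.mem_range.2 (pick_lt W _ hM))
  -- Among the first `M + 1` experts, the last one also receives the whole remaining mass. Admitting
  -- the next expert moves to it exactly the draws with `u ≥ P / S`. For `M + 1 = N` no mass
  -- remains.
  have main : ∀ M, M + 1 ≤ N → ∫ u : unitInterval, f (pick W (u * S) (M + 1)) =
      ∑ j ∈ Finset.range (M + 1), f j * (W j / S) +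
        f M * (1 - (∑ j ∈ Finset.range (M + 1), W j) / S) := by
    intro M
    induction M with
    | zero =>
      intro _
      have : ∀ τ, pick W τ 1 = 0 := fun τ => ite_self 0
      simp [this]
      ring
    | succ M ih =>
      intro hM
      set P := ∑ j ∈ Finset.range (M + 1), W j with hP
      have hP0 : 0 ≤ P := Finset.sum_nonneg fun j hj =>
        (hW j (by have := Finset.mem_range.1 hj; omega)).le
      have hPS : P ≤ S := Finset.sum_le_sum_of_subset_of_nonneg
        (Finset.range_mono (by omega)) fun j hj _ => (hW j (Finset.mem_range.1 hj)).le
      let c : unitInterval := ⟨P / S, div_nonneg hP0 hSpos.le, div_le_one_of_le₀ hPS hSpos.le⟩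
      have hpt : ∀ u : unitInterval, f (pick W (u * S) (M + 1 + 1)) =
          f (pick W (u * S) (M + 1)) + (Ici c).indicator (fun _ => f (M + 1) - f M) u := by
        intro u
        have hc : u ∈ Ici c ↔ P ≤ u * S := by
          rw [mem_Ici, ← Subtype.coe_le_coe, div_le_iff₀ hSpos]
        by_cases hu : P ≤ u * S
        · rw [indicator_of_mem (hc.2 hu), pick, if_neg (not_lt.2 hu), pick, if_neg]
          · ring
          · rw [not_lt]
            refine le_trans ?_ hu
            rw [hP, Finset.sum_range_succ]
            linarith [hW M (by omega)]
        · rw [indicator_of_notMem (fun h => hu (hc.1 h)), pick, if_pos (not_le.1 hu), add_zero]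
      have hIci : (volume (Ici c)).toReal = 1 - P / S := by
        rw [unitInterval.volume_Ici, ENNReal.toReal_ofReal]
        have := c.2.2
        linarith
      rw [integral_congr_ae (Filter.Eventually.of_forall hpt), integral_add (hint _ (by omega))
        ((integrable_const _).indicator measurableSet_Ici), ih (by omega),
        integral_indicator measurableSet_Ici, setIntegral_const, Measure.real, hIci,
        Finset.sum_range_succ _ (M + 1), Finset.sum_range_succ _ (M + 1), ← hP, smul_eq_mul,
        add_div]
      ring
  obtain ⟨M, rfl⟩ := Nat.exists_eq_succ_of_ne_zero hN
  rw [main M le_rfl, ← hS, div_self hSpos.ne']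
  simp

/-! ### Closed form and running time of the learner. -/

variable {n : ℕ} {σ : ℝ} {V : GreedyVariant} {p q : ℕ}

/-- The number of grid points. -/
def gridSize (n : ℕ) (σ : ℝ) (p : ℕ) : ℕ := ⌈((n : ℝ) + 1 / σ) ^ p⌉₊

/-- The weight of expert `i` before round `t`. -/
def expertWeight (V : GreedyVariant) (σ : ℝ) (q N : ℕ) (x : ℕ → MWISInstance n) (t i : ℕ) : ℝ :=
  ∏ s ∈ Finset.range t, (1 + (x s).cost V ((i : ℝ) / N) / (((n : ℝ) + 1 / σ) ^ q * n))

/-- The number of loop iterations does the rounding: the loop stores `k + 1` in each pass and hence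
ends with the ceiling of its bound. As it writes to array `0`, `Cmd.run_time_le` does not apply and
the time is carried in the invariant. -/
theorem run_gridCmd {U : ℕ → unitInterval} {I : Input} {m : Mem} (hm : m.nat 0 0 = 0) :
    let N := ⌈((I.size : ℝ) + 1 / I.sigma) ^ p⌉₊
    let m' := (gridCmd p).run U I m
    m'.nat 0 0 = N ∧ m'.draws = m.draws ∧ m'.time ≤ m.time + (gridCmd p).timeBound N := by
  intro N m'
  have h := Cmd.run_loop_induction (U := U) (I := I) (a := 1) (e := RExp.scale.npow p)
    (c := .setN 0 (.const 0) (.add (.reg 1) (.const 1))) (m := m)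
    (fun k m' => m'.nat 0 0 = k ∧ m'.draws = m.draws ∧
      m'.time ≤ m.time + ((RExp.scale.npow p).steps + 1 + k * (1 +
        (Cmd.setN 0 (.const 0) (.add (.reg 1) (.const 1))).timeBound N)))
    ⟨hm, rfl, by simp⟩
    (by
      rintro k m' hk ⟨h1, h2, h3⟩
      refine ⟨by simp [Cmd.run, NExp.eval], by simpa [Cmd.run] using h2, ?_⟩
      simp only [Cmd.run, Cmd.timeBound, Mem.tick_time, Mem.storeN_time] at h3 ⊢
      rw [add_one_mul]
      omega)
  rw [RExp.eval_npow, RExp.eval_scale] at h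
  exact h

theorem run_initCmd {U : ℕ → unitInterval} {I : Input} {m : Mem} {N : ℕ} (hm : m.nat 0 0 = N) :
    ∀ i < N, (initCmd.run U I m).real 1 i = 1 := by
  refine Cmd.run_for (U := U) (I := I) (a := 1) (e := .cast (.reg 0))
    (c := .setR 1 (.reg 1) (.const 1)) (m := m) N (by simp [RExp.eval, hm])
    (fun k m' => ∀ i < k, m'.real 1 i = 1) (by simp) ?_
  intro k m' hk h i hi
  by_cases hik : i = k
  · simp [Cmd.run, RExp.eval, hik]
  · simp [Cmd.run, hik, h i (by omega)]

/-- The expert weights are functions of the past instances alone, and exactly one draw is used per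
round. Hence round `t` uses the fresh draw `U t`, on which nothing earlier depends. -/
theorem hedge_memory (U : ℕ → unitInterval) {x : ℕ → MWISInstance n}
    (hx : ∀ t v, 0 ≤ (x t).weight v) (t : ℕ) :
    ((hedge V p q).memory σ U x t).nat 0 0 = gridSize n σ p ∧
    ((hedge V p q).memory σ U x t).draws = t ∧
    ∀ i < gridSize n σ p, ((hedge V p q).memory σ U x t).real 1 i =
      expertWeight V σ q (gridSize n σ p) x t i := by
  induction t with
  | zero =>
    have h := run_gridCmd (U := U) (I := paramInput n σ) (p := p)
      (m := ⟨fun _ _ => 0, fun _ _ => 0, 0, 0⟩) rfl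
    refine ⟨?_, ?_, ?_⟩
    · exact (congrFun (Cmd.run_nat (c := initCmd) rfl _) 0).trans h.1
    · exact (Cmd.run_draws (c := initCmd) rfl _).trans h.2.1
    · intro i hi
      rw [expertWeight, Finset.range_zero, Finset.prod_empty]
      exact run_initCmd h.1 i hi
  | succ t ih =>
    obtain ⟨h0, h1, h2⟩ := ih
    rw [Learner.memory]
    set m := (hedge V p q).memory σ U x t
    have c1 := (run_chooseCmd (U := U) (I := paramInput n σ) h0).2
    have c2 : (chooseCmd.run U (paramInput n σ) m).nat 0 0 = gridSize n σ p := by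
      rw [Cmd.run_nat rfl, h0]
    have c3 : (chooseCmd.run U (paramInput n σ) m).real 1 = m.real 1 := Cmd.run_real rfl _
    refine ⟨?_, ?_, ?_⟩
    · exact (congrFun (Cmd.run_nat (c := updateCmd V q) rfl _) 0).trans c2
    · exact (Cmd.run_draws (c := updateCmd V q) rfl _).trans (c1.trans (by rw [h1]))
    · intro i hi
      refine (run_updateCmd c2 (hx t) i hi).trans ?_
      rw [c3, h2 i hi, expertWeight, expertWeight, Finset.prod_range_succ]

/-- The expert that the learner follows in round `t` if its draw is `u`. -/
def expert (V : GreedyVariant) (σ : ℝ) (p q : ℕ) (x : ℕ → MWISInstance n) (t : ℕ)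
    (u : unitInterval) : ℕ :=
  pick (expertWeight V σ q (gridSize n σ p) x t)
    (u * ∑ j ∈ Finset.range (gridSize n σ p), expertWeight V σ q (gridSize n σ p) x t j)
    (gridSize n σ p)

theorem hedge_action (U : ℕ → unitInterval) {x : ℕ → MWISInstance n}
    (hx : ∀ t v, 0 ≤ (x t).weight v) (t : ℕ) :
    (hedge V p q).action σ U x t = (expert V σ p q x t (U t) : ℝ) / gridSize n σ p := by
  obtain ⟨h0, h1, h2⟩ := hedge_memory (V := V) (σ := σ) (p := p) (q := q) U hx t
  refine (run_chooseCmd h0).1.trans ?_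
  rw [expert, h1, pick_congr h2, Finset.sum_congr rfl fun i hi => h2 i (Finset.mem_range.1 hi)]

theorem two_le_scale (hn : 1 ≤ n) (hσ : 0 < σ) (hσ1 : σ < 1) : 2 ≤ (n : ℝ) + 1 / σ := by
  have h1 : (1 : ℝ) ≤ n := by exact_mod_cast hn
  have h2 : 1 ≤ 1 / σ := by rw [le_div_iff₀ hσ]; linarith
  linarith

theorem gridSize_pos (hn : 1 ≤ n) (hσ : 0 < σ) (hσ1 : σ < 1) : 0 < gridSize n σ p :=
  Nat.ceil_pos.2 (pow_pos (by linarith [two_le_scale hn hσ hσ1]) _)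

theorem expert_lt (hn : 1 ≤ n) (hσ : 0 < σ) (hσ1 : σ < 1) (x : ℕ → MWISInstance n) (t : ℕ)
    (u : unitInterval) : expert V σ p q x t u < gridSize n σ p :=
  pick_lt _ _ (gridSize_pos hn hσ hσ1).ne'

theorem hedge_action_mem (hn : 1 ≤ n) (hσ : 0 < σ) (hσ1 : σ < 1) (U : ℕ → unitInterval)
    {x : ℕ → MWISInstance n} (hx : ∀ t v, 0 ≤ (x t).weight v) (t : ℕ) :
    (hedge V p q).action σ U x t ∈ Icc (0 : ℝ) 1 := by
  rw [hedge_action U hx]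
  have := expert_lt (V := V) (p := p) (q := q) hn hσ hσ1 x t (U t)
  exact ⟨by positivity, div_le_one_of_le₀ (by exact_mod_cast this.le) (by positivity)⟩

/-- After the grid size is stored, every loop has at most `n + gridSize n σ p` iterations; only
`gridCmd` needs its own estimate. -/
theorem hedge_time (V : GreedyVariant) (p q : ℕ) : ∃ K : ℕ, ∀ (n : ℕ) (σ : ℝ)
    (x : ℕ → MWISInstance n) (U : ℕ → unitInterval), (∀ t v, 0 ≤ (x t).weight v) →
    ((hedge V p q).memory σ U x 0).time ≤ K * (n + gridSize n σ p + 1) ^ K ∧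
    ∀ t, ((hedge V p q).memory σ U x (t + 1)).time ≤ ((hedge V p q).memory σ U x t).time +
      K * (n + gridSize n σ p + 1) ^ K := by
  obtain ⟨K1, hK1⟩ := Cmd.exists_timeBound_le (hedge V p q).start
  obtain ⟨K2, hK2⟩ := Cmd.exists_timeBound_le (.seq (hedge V p q).choose (hedge V p q).update)
  refine ⟨K1 + K2, fun n σ x U hx => ?_⟩
  set N := gridSize n σ p with hN
  have hle : ∀ K ≤ K1 + K2, ∀ B ≤ n + N, K * (B + 1) ^ K ≤ (K1 + K2) * (n + N + 1) ^ (K1 + K2) :=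
    fun K hK B hB => by
      calc K * (B + 1) ^ K ≤ (K1 + K2) * (n + N + 1) ^ K := by gcongr
        _ ≤ _ := by gcongr; omega
  constructor
  · have h := run_gridCmd (U := U) (I := paramInput n σ) (p := p)
      (m := ⟨fun _ _ => 0, fun _ _ => 0, 0, 0⟩) rfl
    have h1 := Cmd.run_time_le (U := U) (c := initCmd) (I := paramInput n σ) (N := N) (B := N) rfl
      ⟨fun m hm => by simp [RExp.eval, hm], trivial⟩ _ h.1
    have h2 : ((hedge V p q).memory σ U x 0).time ≤ (hedge V p q).start.timeBound N := by
      refine h1.trans ?_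
      have := h.2.2
      simp only [zero_add] at this
      exact Nat.add_le_add_right this _
    exact h2.trans ((hK1 N).trans (hle _ (by omega) _ (by omega)))
  · intro t
    have h0 := (hedge_memory (V := V) (σ := σ) (p := p) (q := q) U hx t).1
    rw [Learner.memory]
    set m := (hedge V p q).memory σ U x t
    have h1 := Cmd.run_time_le (U := U) (c := chooseCmd) (I := paramInput n σ) (N := N)
      (B := n + N) rfl
      (by simp +contextual [chooseCmd, Cmd.LoopsBounded, RExp.eval]) m h0
    have c2 : (chooseCmd.run U (paramInput n σ) m).nat 0 0 = N := by
      rw [Cmd.run_nat rfl, h0]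
    have h2 := Cmd.run_time_le (U := U) (c := updateCmd V q) (I := instanceInput σ (x t)) (N := N)
      (B := n + N) rfl
      (by simp +contextual [updateCmd, greedyCmd, stepCmd, blockCmd, argmaxCmd, scanCmd, powCmd,
        degCmd, Cmd.LoopsBounded, RExp.eval, NExp.eval, instanceInput])
      (chooseCmd.run U (paramInput n σ) m) c2
    have h3 := (hK2 (n + N)).trans (hle K2 (by omega) _ le_rfl)
    have h4 : (Cmd.seq (hedge V p q).choose (hedge V p q).update).timeBound (n + N) =
      chooseCmd.timeBound (n + N) + (updateCmd V q).timeBound (n + N) := rfl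
    have h5 : (Cmd.run U (instanceInput σ (x t)) (hedge V p q).update
      (Cmd.run U (paramInput n σ) (hedge V p q).choose m)) = (Cmd.run U (instanceInput σ (x t))
        (updateCmd V q) (Cmd.run U (paramInput n σ) chooseCmd m)) := rfl
    rw [h5]
    omega

end RealRAM
end

/-! ### How the cost depends on the parameter. -/

noncomputable section

namespace MWISInstance

variable {n : ℕ} {V : GreedyVariant}

/-- For all degrees that can occur, the parameters `ρ` and `ρ'` rank the scores of any two vertices
in the same way. -/
def SameOrder (w : Fin n → ℝ) (ρ ρ' : ℝ) : Prop :=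
  ∀ u v : Fin n, u ≠ v → ∀ a ∈ Finset.Icc 1 n, ∀ b ∈ Finset.Icc 1 n, a ≠ b →
    (w u * (b : ℝ) ^ ρ ≤ w v * (a : ℝ) ^ ρ ↔ w u * (b : ℝ) ^ ρ' ≤ w v * (a : ℝ) ^ ρ')

theorem deg_lt (x : MWISInstance n) (S : Finset (Fin n)) (v : Fin n) : x.deg V S v < n := by
  classical
  have h : x.deg V S v ≤ (Finset.univ.erase v).card := by
    cases V <;>
    · simp only [deg]
      refine Finset.card_le_card fun u hu => ?_
      have := (Finset.mem_filter.1 hu).2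
      simpa using (x.graph.ne_of_adj this).symm
  rw [Finset.card_erase_of_mem (Finset.mem_univ _), Finset.card_univ, Fintype.card_fin] at h
  have := v.2
  omega

theorem score_le_iff (x : MWISInstance n) (ρ : ℝ) (S : Finset (Fin n)) (u v : Fin n) :
    x.score V ρ S u ≤ x.score V ρ S v ↔
      x.weight u * ((x.deg V S v + 1 : ℕ) : ℝ) ^ ρ ≤
        x.weight v * ((x.deg V S u + 1 : ℕ) : ℝ) ^ ρ := by
  have h : ∀ v, (0 : ℝ) < (1 + (x.deg V S v : ℝ)) ^ ρ := fun v =>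
    Real.rpow_pos_of_pos (by positivity) _
  rw [score, score, div_le_div_iff₀ (h u) (h v)]
  push_cast
  rw [add_comm (1 : ℝ), add_comm (1 : ℝ)]

/-- The heuristic uses the parameter only to compare scores. Vertices of equal degree compare in the
same way for every parameter, so `SameOrder` may be restricted to `a ≠ b`; the values `deg + 1` lie
between `1` and `n`. -/
theorem cost_congr {x : MWISInstance n} {ρ ρ' : ℝ} (h : SameOrder x.weight ρ ρ') :
    x.cost V ρ = x.cost V ρ' := by
  have hs : ∀ S u v, x.score V ρ S u ≤ x.score V ρ S v ↔ x.score V ρ' S u ≤ x.score V ρ' S v := by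
    intro S u v
    rw [score_le_iff, score_le_iff]
    by_cases huv : u = v
    · subst huv
      simp
    by_cases hd : x.deg V S u = x.deg V S v
    · rw [hd]
      have h : ∀ ρ : ℝ, (0 : ℝ) < ((x.deg V S v + 1 : ℕ) : ℝ) ^ ρ := fun ρ =>
        Real.rpow_pos_of_pos (by positivity) _
      rw [mul_le_mul_iff_left₀ (h ρ), mul_le_mul_iff_left₀ (h ρ')]
    · have h1 := deg_lt (V := V) x S u
      have h2 := deg_lt (V := V) x S v
      exact h u v huv _ (Finset.mem_Icc.2 (by omega)) _ (Finset.mem_Icc.2 (by omega)) (by omega)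
  have hb : ∀ S, x.best V ρ S = x.best V ρ' S := by
    intro S
    simp only [best, hs]
  have hg : ∀ k S, x.greedy V ρ k S = x.greedy V ρ' k S := by
    intro k
    induction k with
    | zero => intro S; rfl
    | succ k ih =>
      intro S
      rw [greedy, greedy]
      have e := hb S
      generalize x.best V ρ S = B at e ⊢
      subst e
      simp only [ih]
  rw [cost, cost, output, output, hg]

theorem cost_mem_Icc {x : MWISInstance n} (hx : ∀ v, x.weight v ∈ Icc (0 : ℝ) 1) (ρ : ℝ) :
    x.cost V ρ ∈ Icc (0 : ℝ) n := by
  refine ⟨Finset.sum_nonneg fun v _ => (hx v).1, ?_⟩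
  calc x.cost V ρ ≤ ∑ v ∈ x.output V ρ, (1 : ℝ) := Finset.sum_le_sum fun v _ => (hx v).2
    _ = (x.output V ρ).card := by simp
    _ ≤ n := by exact_mod_cast (Finset.card_le_univ _).trans_eq (Fintype.card_fin n)

/-! ### Measurability of the cost and of its supremum. -/

theorem measurable_score (G : SimpleGraph (Fin n)) (S : Finset (Fin n)) (v : Fin n) :
    Measurable fun p : ℝ × (Fin n → ℝ) => (⟨G, p.2⟩ : MWISInstance n).score V p.1 S v := by
  have h : ∀ p : ℝ × (Fin n → ℝ), (⟨G, p.2⟩ : MWISInstance n).deg V S v =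
      (⟨G, 0⟩ : MWISInstance n).deg V S v := fun p => by cases V <;> rfl
  simp only [score, h]
  exact ((measurable_pi_apply v).comp measurable_snd).div (measurable_const.pow measurable_fst)

theorem measurableSet_best_eq (G : SimpleGraph (Fin n)) (S B : Finset (Fin n)) :
    MeasurableSet {p : ℝ × (Fin n → ℝ) | (⟨G, p.2⟩ : MWISInstance n).best V p.1 S = B} := by
  have h : {p : ℝ × (Fin n → ℝ) | (⟨G, p.2⟩ : MWISInstance n).best V p.1 S = B} =
      ⋂ v, {p | (v ∈ S ∧ ∀ u ∈ S, (⟨G, p.2⟩ : MWISInstance n).score V p.1 S u ≤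
        (⟨G, p.2⟩ : MWISInstance n).score V p.1 S v) ↔ v ∈ B} := by
    ext p
    simp [best, Finset.ext_iff]
  rw [h]
  refine MeasurableSet.iInter fun v => ?_
  have h1 : MeasurableSet {p : ℝ × (Fin n → ℝ) | v ∈ S ∧ ∀ u ∈ S,
      (⟨G, p.2⟩ : MWISInstance n).score V p.1 S u ≤
        (⟨G, p.2⟩ : MWISInstance n).score V p.1 S v} := by
    have : {p : ℝ × (Fin n → ℝ) | v ∈ S ∧ ∀ u ∈ S, (⟨G, p.2⟩ : MWISInstance n).score V p.1 S u ≤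
        (⟨G, p.2⟩ : MWISInstance n).score V p.1 S v} = {_p | v ∈ S} ∩ ⋂ u ∈ S, {p |
        (⟨G, p.2⟩ : MWISInstance n).score V p.1 S u ≤
        (⟨G, p.2⟩ : MWISInstance n).score V p.1 S v} := by ext; simp
    rw [this]
    exact (MeasurableSet.const _).inter (Finset.measurableSet_biInter _ fun u _ =>
      measurableSet_le (measurable_score G S u) (measurable_score G S v))
  by_cases hv : v ∈ B
  · simpa only [hv, iff_true] using h1
  · simp only [hv, iff_false]
    exact h1.compl

/-- There are finitely many possible sets of best vertices. Once this set is fixed, the selected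
vertex and the set passed to the recursion no longer depend on the weights or the parameter. -/
theorem measurableSet_greedy_eq (G : SimpleGraph (Fin n)) (k : ℕ) (S A : Finset (Fin n)) :
    MeasurableSet {p : ℝ × (Fin n → ℝ) | (⟨G, p.2⟩ : MWISInstance n).greedy V p.1 k S = A} := by
  classical
  induction k generalizing S A with
  | zero => exact MeasurableSet.const (∅ = A)
  | succ k ih =>
    have h : {p : ℝ × (Fin n → ℝ) | (⟨G, p.2⟩ : MWISInstance n).greedy V p.1 (k + 1) S = A} =
        ⋃ B, {p | (⟨G, p.2⟩ : MWISInstance n).best V p.1 S = B} ∩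
          {p | (if h : B.Nonempty then insert (B.min' h) ((⟨G, p.2⟩ : MWISInstance n).greedy V p.1 k
            (S.filter fun u => u ≠ B.min' h ∧ ¬ G.Adj (B.min' h) u)) else ∅) = A} := by
      ext p
      simp [greedy]
    rw [h]
    refine MeasurableSet.iUnion fun B => (measurableSet_best_eq G S B).inter ?_
    by_cases hB : B.Nonempty
    · simp only [hB, dif_pos]
      have : {p : ℝ × (Fin n → ℝ) | insert (B.min' hB) ((⟨G, p.2⟩ : MWISInstance n).greedy V p.1 k
            (S.filter fun u => u ≠ B.min' hB ∧ ¬ G.Adj (B.min' hB) u)) = A} =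
          ⋃ A' ∈ {A' : Finset (Fin n) | insert (B.min' hB) A' = A},
            {p | (⟨G, p.2⟩ : MWISInstance n).greedy V p.1 k
            (S.filter fun u => u ≠ B.min' hB ∧ ¬ G.Adj (B.min' hB) u) = A'} := by
        ext p
        simp
      rw [this]
      exact MeasurableSet.biUnion (to_countable _) fun A' _ => ih _ _
    · simp only [hB, dif_neg, not_false_eq_true]
      exact MeasurableSet.const _

/-- The performance is a measurable function of the parameter and the weights. -/
theorem measurable_cost (G : SimpleGraph (Fin n)) :
    Measurable fun p : ℝ × (Fin n → ℝ) => (⟨G, p.2⟩ : MWISInstance n).cost V p.1 := by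
  classical
  have h : (fun p : ℝ × (Fin n → ℝ) => (⟨G, p.2⟩ : MWISInstance n).cost V p.1) = fun p =>
      ∑ A : Finset (Fin n), if (⟨G, p.2⟩ : MWISInstance n).output V p.1 = A then
        ∑ v ∈ A, p.2 v else 0 := by
    ext p
    simp [cost]
  rw [h]
  refine Finset.measurable_sum _ fun A _ => Measurable.ite (measurableSet_greedy_eq G n _ A)
    (Finset.measurable_sum _ fun v _ => (measurable_pi_apply v).comp measurable_snd)
    measurable_const

/-- Two scores keep their order near `r`, unless `r` is the parameter where they cross. -/
theorem eventually_le_iff_or_eq {a b : ℕ} (ha : 1 ≤ a) (hb : 1 ≤ b) (hab : a ≠ b) (y z r : ℝ) :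
    (∀ᶠ ρ in nhds r, (y * (b : ℝ) ^ r ≤ z * (a : ℝ) ^ r ↔ y * (b : ℝ) ^ ρ ≤ z * (a : ℝ) ^ ρ)) ∨
      r = Real.log (y / z) / Real.log ((a : ℝ) / b) := by
  have ha0 : (0 : ℝ) < a := by exact_mod_cast ha
  have hb0 : (0 : ℝ) < b := by exact_mod_cast hb
  have cb : Continuous fun ρ : ℝ => y * (b : ℝ) ^ ρ :=
    continuous_const.mul (Real.continuous_const_rpow hb0.ne')
  have ca : Continuous fun ρ : ℝ => z * (a : ℝ) ^ ρ :=
    continuous_const.mul (Real.continuous_const_rpow ha0.ne')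
  rcases lt_trichotomy (y * (b : ℝ) ^ r) (z * (a : ℝ) ^ r) with h | h | h
  · left
    filter_upwards [cb.continuousAt.eventually_lt ca.continuousAt h] with ρ hρ
    exact iff_of_true h.le hρ.le
  · have pa := Real.rpow_pos_of_pos ha0 r
    have pb := Real.rpow_pos_of_pos hb0 r
    -- If `z = 0` then `y = 0` and the comparison is an equality for every parameter. Otherwise
    -- equality says `(a / b) ^ r = y / z`, which determines `r` because `a ≠ b`.
    by_cases hz : z = 0
    · left
      have hy : y = 0 := by simpa [hz, pb.ne'] using h
      simp [hz, hy]
    · right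
      have hlog : Real.log ((a : ℝ) / b) ≠ 0 := by
        apply Real.log_ne_zero_of_pos_of_ne_one (by positivity)
        rw [Ne, div_eq_one_iff_eq hb0.ne']
        exact_mod_cast hab
      have : y / z = ((a : ℝ) / b) ^ r := by
        rw [Real.div_rpow ha0.le hb0.le, div_eq_div_iff hz pb.ne', h, mul_comm]
      rw [this, Real.log_rpow (by positivity), mul_div_cancel_right₀ _ hlog]
  · left
    filter_upwards [ca.continuousAt.eventually_lt cb.continuousAt h] with ρ hρ
    exact iff_of_false (not_le.2 h) (not_le.2 hρ)

/-- Countably many parameters, depending on the weights, that suffice for the supremum over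
`[0, 1]`: the rational numbers and the parameters at which two scores cross. -/
def selector (w : ℕ → Fin n → ℝ) :
    {q : ℚ // (q : ℝ) ∈ Icc (0 : ℝ) 1} ⊕ (ℕ × Fin n × Fin n × ℕ × ℕ) → Icc (0 : ℝ) 1
  | .inl q => ⟨q.1, q.2⟩
  | .inr (t, u, v, a, b) => projIcc 0 1 zero_le_one
      (Real.log (w t u / w t v) / Real.log ((a : ℝ) / b))

/-- Either `r` is itself one of the listed crossing parameters, or all the finitely many comparisons
are constant near `r` and a nearby rational has the same costs. This makes the uncountable supremum
a countable one. -/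
theorem exists_selector (G : ℕ → SimpleGraph (Fin n)) (w : ℕ → Fin n → ℝ) (T : ℕ)
    (r : Icc (0 : ℝ) 1) : ∃ j, ∑ t ∈ Finset.range T, (instances G w t).cost V r =
      ∑ t ∈ Finset.range T, (instances G w t).cost V (selector w j) := by
  by_cases h : ∃ j, (selector w (.inr j)) = r
  · obtain ⟨j, hj⟩ := h
    exact ⟨.inr j, by rw [hj]⟩
  have hev : ∀ᶠ ρ in nhds (r : ℝ), ∀ t ∈ Finset.range T, ∀ u v : Fin n,
      ∀ a ∈ Finset.Icc 1 n, ∀ b ∈ Finset.Icc 1 n, a ≠ b →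
      (w t u * (b : ℝ) ^ (r : ℝ) ≤ w t v * (a : ℝ) ^ (r : ℝ) ↔
        w t u * (b : ℝ) ^ ρ ≤ w t v * (a : ℝ) ^ ρ) := by
    rw [Finset.eventually_all]
    intro t _
    rw [Filter.eventually_all]
    intro u
    rw [Filter.eventually_all]
    intro v
    rw [Finset.eventually_all]
    intro a ha
    rw [Finset.eventually_all]
    intro b hb
    by_cases hab : a = b
    · simp [hab]
    refine ((eventually_le_iff_or_eq (Finset.mem_Icc.1 ha).1 (Finset.mem_Icc.1 hb).1 hab (w t u)
      (w t v) r).resolve_right fun he => h ⟨(t, u, v, a, b), ?_⟩).mono fun ρ hρ _ => hρ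
    rw [selector, ← he, projIcc_val]
  obtain ⟨ε, hε, hball⟩ := Metric.eventually_nhds_iff.1 hev
  -- The rational must lie in `[0, 1]` as well as near `r`, also when `r` is an endpoint.
  have hlt : max 0 ((r : ℝ) - ε) < min 1 ((r : ℝ) + ε) := by
    have h0 := r.2.1
    have h1 := r.2.2
    rw [max_lt_iff, lt_min_iff, lt_min_iff]
    exact ⟨⟨one_pos, by linarith⟩, by linarith, by linarith⟩
  obtain ⟨q, hq1, hq2⟩ := exists_rat_btwn hlt
  rw [max_lt_iff] at hq1
  rw [lt_min_iff] at hq2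
  refine ⟨.inl ⟨q, hq1.1.le, hq2.1.le⟩, Finset.sum_congr rfl fun t ht => cost_congr ?_⟩
  intro u v _ a ha b hb hab
  refine hball (y := (q : ℝ)) ?_ t ht u v a ha b hb hab
  rw [Real.dist_eq, abs_lt]
  exact ⟨by linarith, by linarith⟩

theorem measurable_selector
    (j : {q : ℚ // (q : ℝ) ∈ Icc (0 : ℝ) 1} ⊕ (ℕ × Fin n × Fin n × ℕ × ℕ)) :
    Measurable fun w : ℕ → Fin n → ℝ => (selector w j : ℝ) := by
  rcases j with q | ⟨t, u, v, a, b⟩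
  · exact measurable_const
  · simp only [selector, coe_projIcc]
    have h : ∀ v : Fin n, Measurable fun w : ℕ → Fin n → ℝ => w t v := fun v =>
      (measurable_pi_apply v).comp (measurable_pi_apply t)
    exact measurable_const.max (measurable_const.min
      ((Real.measurable_log.comp ((h u).div (h v))).div measurable_const))

/-- The performance of the best fixed parameter is a measurable function of the weights. -/
theorem measurable_iSup_cost (G : ℕ → SimpleGraph (Fin n)) (T : ℕ) :
    Measurable fun w : ℕ → Fin n → ℝ =>
      ⨆ r : Icc (0 : ℝ) 1, ∑ t ∈ Finset.range T, (instances G w t).cost V r := by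
  have h : (fun w : ℕ → Fin n → ℝ =>
      ⨆ r : Icc (0 : ℝ) 1, ∑ t ∈ Finset.range T, (instances G w t).cost V r) = fun w =>
      ⨆ j, ∑ t ∈ Finset.range T, (instances G w t).cost V (selector w j) := by
    ext w
    rw [iSup, iSup]
    congr 1
    ext y
    constructor
    · rintro ⟨r, rfl⟩
      obtain ⟨j, hj⟩ := exists_selector (V := V) G w T r
      exact ⟨j, hj.symm⟩
    · rintro ⟨j, rfl⟩
      exact ⟨selector w j, rfl⟩
  rw [h]
  refine Measurable.iSup fun j => Finset.measurable_sum _ fun t _ => ?_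
  exact (measurable_cost (V := V) (G t)).comp
    ((measurable_selector j).prodMk (measurable_pi_apply t))

/-! ### Cells of the grid without crossings. -/

/-- Some two scores may cross at a parameter between `i / N` and `(i + 1) / N`. -/
def crossing (n N i : ℕ) : Set (Fin n → ℝ) :=
  ⋃ u, ⋃ v, ⋃ (_ : u ≠ v), ⋃ a ∈ Finset.Icc 1 n, ⋃ b ∈ Finset.Icc 1 n, ⋃ (_ : a < b),
    {w | w v ∈ Icc (w u * ((b : ℝ) / a) ^ ((i : ℝ) / N))
      (w u * ((b : ℝ) / a) ^ (((i : ℝ) + 1) / N))}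

theorem measurableSet_crossing (n N i : ℕ) : MeasurableSet (crossing n N i) := by
  refine MeasurableSet.iUnion fun u => MeasurableSet.iUnion fun v => MeasurableSet.iUnion fun _ =>
    Finset.measurableSet_biUnion _ fun a _ => Finset.measurableSet_biUnion _ fun b _ =>
    MeasurableSet.iUnion fun _ => ?_
  exact (measurableSet_le ((measurable_pi_apply u).mul_const _) (measurable_pi_apply v)).inter
    (measurableSet_le (measurable_pi_apply v) ((measurable_pi_apply u).mul_const _))

/-- After division by `a ^ ρ` the comparison is between `w u * (b / a) ^ ρ` and `w v`. For `a < b`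
the former is monotone in `ρ`, so it stays within its endpoint values on the cell; if `w v` is
outside that range, the order is strict and constant. The case `a > b` follows by exchanging the
vertices. -/
theorem sameOrder_of_notMem_crossing {N i : ℕ} {w : Fin n → ℝ} (hw : ∀ v, 0 ≤ w v)
    (h : w ∉ crossing n N i) {r : ℝ} (hr : r ∈ Icc ((i : ℝ) / N) (((i : ℝ) + 1) / N)) :
    SameOrder w r ((i : ℝ) / N) := by
  simp only [crossing, mem_iUnion, not_exists, mem_ofPred_eq, mem_Icc, not_and, not_le] at h
  have hi : (i : ℝ) / N ∈ Icc ((i : ℝ) / N) (((i : ℝ) + 1) / N) := ⟨le_rfl, hr.1.trans hr.2⟩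
  have key : ∀ u v : Fin n, u ≠ v → ∀ a ∈ Finset.Icc 1 n, ∀ b ∈ Finset.Icc 1 n, a < b →
      (∀ ρ ∈ Icc ((i : ℝ) / N) (((i : ℝ) + 1) / N), w v * (a : ℝ) ^ ρ < w u * (b : ℝ) ^ ρ) ∨
      (∀ ρ ∈ Icc ((i : ℝ) / N) (((i : ℝ) + 1) / N), w u * (b : ℝ) ^ ρ < w v * (a : ℝ) ^ ρ) := by
    intro u v huv a ha b hb hab
    have ha0 : (0 : ℝ) < a := by exact_mod_cast (Finset.mem_Icc.1 ha).1
    have hab' : (a : ℝ) < b := by exact_mod_cast hab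
    have hc : 1 ≤ (b : ℝ) / a := by rw [le_div_iff₀ ha0]; linarith
    have hdiv : ∀ ρ : ℝ, w u * (b : ℝ) ^ ρ = w u * ((b : ℝ) / a) ^ ρ * (a : ℝ) ^ ρ := by
      intro ρ
      rw [mul_assoc, ← Real.mul_rpow (by positivity) ha0.le, div_mul_cancel₀ _ ha0.ne']
    have hpos : ∀ ρ : ℝ, 0 < (a : ℝ) ^ ρ := fun ρ => Real.rpow_pos_of_pos ha0 ρ
    by_cases h1 : w u * ((b : ℝ) / a) ^ ((i : ℝ) / N) ≤ w v
    · right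
      intro ρ hρ
      rw [hdiv, mul_lt_mul_iff_left₀ (hpos ρ)]
      refine lt_of_le_of_lt ?_ (h u v huv a ha b hb hab h1)
      exact mul_le_mul_of_nonneg_left (Real.rpow_le_rpow_of_exponent_le hc hρ.2) (hw u)
    · left
      intro ρ hρ
      rw [hdiv, mul_lt_mul_iff_left₀ (hpos ρ)]
      refine lt_of_lt_of_le (not_le.1 h1) ?_
      exact mul_le_mul_of_nonneg_left (Real.rpow_le_rpow_of_exponent_le hc hρ.1) (hw u)
  intro u v huv a ha b hb hab
  rcases lt_or_gt_of_ne hab with hlt | hlt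
  · rcases key u v huv a ha b hb hlt with h | h
    · exact iff_of_false (not_le.2 (h _ hr)) (not_le.2 (h _ hi))
    · exact iff_of_true (h _ hr).le (h _ hi).le
  · rcases key v u huv.symm b hb a ha hlt with h | h
    · exact iff_of_true (h _ hr).le (h _ hi).le
    · exact iff_of_false (not_le.2 (h _ hr)) (not_le.2 (h _ hi))

end MWISInstance
end

/-! ### The probability of a crossing. -/

noncomputable section

open ProbabilityTheory

theorem IsSmooth.measure_Icc_le {σ : ℝ} {μ : Measure ℝ} (h : IsSmooth σ μ) (hσ : 0 < σ) (a b : ℝ) :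
    μ (Icc a b) ≤ ENNReal.ofReal ((b - a) / σ) := by
  obtain ⟨f, -, hf, -, rfl⟩ := h
  rw [withDensity_apply _ measurableSet_Icc]
  calc ∫⁻ y in Icc a b, f y ≤ ∫⁻ _ in Icc a b, ENNReal.ofReal (1 / σ) := lintegral_mono hf
    _ = ENNReal.ofReal (1 / σ) * ENNReal.ofReal (b - a) := by
      rw [setLIntegral_const, Real.volume_Icc]
    _ = ENNReal.ofReal ((b - a) / σ) := by
      rw [← ENNReal.ofReal_mul (by positivity), one_div_mul_eq_div]

theorem IsSmooth.ae_mem {σ : ℝ} {μ : Measure ℝ} (h : IsSmooth σ μ) :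
    ∀ᵐ y ∂μ, y ∈ Icc (0 : ℝ) 1 := by
  obtain ⟨f, -, -, hf, rfl⟩ := h
  rw [ae_iff]
  change (volume.withDensity f) (Icc (0 : ℝ) 1)ᶜ = 0
  rw [withDensity_apply _ measurableSet_Icc.compl]
  exact setLIntegral_eq_zero measurableSet_Icc.compl fun y hy => hf y hy

/-- The difference is `c ^ (i / N) * (c ^ (1 / N) - 1)`; the first factor is at most `M`, and
Bernoulli's inequality bounds the second by `(c - 1) / N`. -/
theorem rpow_sub_rpow_le {c M : ℝ} (hc : 1 ≤ c) (hcM : c ≤ M) {N i : ℕ} (hi : i < N) :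
    c ^ (((i : ℝ) + 1) / N) - c ^ ((i : ℝ) / N) ≤ M ^ 2 / N := by
  have hN : (0 : ℝ) < N := by exact_mod_cast (Nat.zero_le i).trans_lt hi
  have hN1 : (1 : ℝ) ≤ N := by exact_mod_cast (Nat.zero_le i).trans_lt hi
  have h1 : c ^ ((i : ℝ) / N) ≤ M := by
    refine le_trans ?_ hcM
    conv_rhs => rw [← Real.rpow_one c]
    refine Real.rpow_le_rpow_of_exponent_le hc (div_le_one_of_le₀ ?_ hN.le)
    exact_mod_cast hi.le
  have h2 : c ^ (1 / (N : ℝ)) ≤ 1 + 1 / (N : ℝ) * (c - 1) := by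
    have := rpow_one_add_le_one_add_mul_self (s := c - 1) (by linarith) (p := 1 / (N : ℝ))
      (by positivity) (by rw [div_le_one hN]; exact hN1)
    simpa using this
  have h3 : c ^ (1 / (N : ℝ)) - 1 ≤ M / N := by
    have : 1 / (N : ℝ) * (c - 1) ≤ M / N := by
      rw [one_div_mul_eq_div]
      exact div_le_div_of_nonneg_right (by linarith) hN.le
    linarith
  have h4 : 0 ≤ c ^ (1 / (N : ℝ)) - 1 := by
    have := Real.one_le_rpow hc (by positivity : 0 ≤ 1 / (N : ℝ))
    linarith
  rw [add_div, Real.rpow_add (by linarith), ← mul_sub_one]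
  calc _ ≤ M * (M / N) := mul_le_mul h1 h3 h4 (by linarith)
    _ = M ^ 2 / N := by ring

/-- Given `w u = z`, which is in `[0, 1]` almost surely, the independent weight `w v` must hit an
interval of length `z * (c' - c) ≤ K`. -/
theorem measure_pi_pair_le {n : ℕ} {σ : ℝ} (hσ : 0 < σ) {μ : Fin n → Measure ℝ}
    [∀ v, IsProbabilityMeasure (μ v)] (hμ : ∀ v, IsSmooth σ (μ v)) {u v : Fin n} (huv : u ≠ v)
    {c c' K : ℝ} (hc : c' - c ≤ K) (hK : 0 ≤ K) :
    Measure.pi μ {w | w v ∈ Icc (w u * c) (w u * c')} ≤ ENNReal.ofReal (K / σ) := by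
  have hind : IndepFun (fun w : Fin n → ℝ => w u) (fun w => w v) (Measure.pi μ) :=
    (iIndepFun_pi (μ := μ) (X := fun _ => id) fun _ => aemeasurable_id).indepFun huv
  have hmap : (Measure.pi μ).map (fun w => (w u, w v)) = (μ u).prod (μ v) := by
    rw [(indepFun_iff_map_prod_eq_prod_map_map (measurable_pi_apply u).aemeasurable
      (measurable_pi_apply v).aemeasurable).1 hind]
    congr 1
    · exact (measurePreserving_eval μ u).map_eq
    · exact (measurePreserving_eval μ v).map_eq
  have hs : MeasurableSet {z : ℝ × ℝ | z.2 ∈ Icc (z.1 * c) (z.1 * c')} :=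
    (measurableSet_le (measurable_fst.mul_const _) measurable_snd).inter
      (measurableSet_le measurable_snd (measurable_fst.mul_const _))
  have h1 : Measure.pi μ {w | w v ∈ Icc (w u * c) (w u * c')} =
      (μ u).prod (μ v) {z | z.2 ∈ Icc (z.1 * c) (z.1 * c')} := by
    rw [← hmap, Measure.map_apply ((measurable_pi_apply u).prodMk (measurable_pi_apply v)) hs]
    rfl
  rw [h1, Measure.prod_apply hs]
  calc ∫⁻ z, μ v (Prod.mk z ⁻¹' {z | z.2 ∈ Icc (z.1 * c) (z.1 * c')}) ∂μ u
      ≤ ∫⁻ _, ENNReal.ofReal (K / σ) ∂μ u := by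
        refine lintegral_mono_ae ?_
        filter_upwards [(hμ u).ae_mem] with z hz
        refine ((hμ v).measure_Icc_le hσ (z * c) (z * c')).trans (ENNReal.ofReal_le_ofReal ?_)
        refine div_le_div_of_nonneg_right ?_ hσ.le
        rw [← mul_sub]
        nlinarith [hz.1, hz.2]
    _ = _ := by simp

/-- Union bound over at most `n ^ 4` choices of two vertices and two degrees, each contributing at
most `n ^ 2 / (N * σ)`. -/
theorem measure_crossing_le {n : ℕ} {σ : ℝ} (hσ : 0 < σ) {μ : Fin n → Measure ℝ}
    [∀ v, IsProbabilityMeasure (μ v)] (hμ : ∀ v, IsSmooth σ (μ v)) {N i : ℕ} (hi : i < N) :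
    (Measure.pi μ).real (MWISInstance.crossing n N i) ≤ (n : ℝ) ^ 6 / (N * σ) := by
  set K : ℝ≥0∞ := ENNReal.ofReal (((n : ℝ) ^ 2 / N) / σ) with hK
  have h1 : Measure.pi μ (MWISInstance.crossing n N i) ≤
      ∑ _u : Fin n, ∑ _v : Fin n, ∑ _a ∈ Finset.Icc 1 n, ∑ _b ∈ Finset.Icc 1 n, K := by
    refine (measure_iUnion_fintype_le _ _).trans (Finset.sum_le_sum fun u _ => ?_)
    refine (measure_iUnion_fintype_le _ _).trans (Finset.sum_le_sum fun v _ => ?_)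
    by_cases huv : u = v
    · simp [huv]
    simp only [ne_eq, huv, not_false_eq_true, iUnion_true]
    refine (measure_biUnion_finset_le _ _).trans (Finset.sum_le_sum fun a ha => ?_)
    refine (measure_biUnion_finset_le _ _).trans (Finset.sum_le_sum fun b hb => ?_)
    by_cases hab : a < b
    · simp only [hab, iUnion_true]
      have ha1 : (1 : ℝ) ≤ a := by exact_mod_cast (Finset.mem_Icc.1 ha).1
      have hab' : (a : ℝ) < b := by exact_mod_cast hab
      have hbn : (b : ℝ) ≤ n := by exact_mod_cast (Finset.mem_Icc.1 hb).2
      refine measure_pi_pair_le hσ hμ huv (rpow_sub_rpow_le ?_ ?_ hi) (by positivity)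
      · rw [le_div_iff₀ (by linarith)]; linarith
      · rw [div_le_iff₀ (by linarith)]; nlinarith
    · simp [hab]
  have h2 : ∑ _u : Fin n, ∑ _v : Fin n, ∑ _a ∈ Finset.Icc 1 n, ∑ _b ∈ Finset.Icc 1 n, K =
      ENNReal.ofReal ((n : ℝ) ^ 6 / (N * σ)) := by
    simp only [Finset.sum_const, Finset.card_univ, Fintype.card_fin, Nat.card_Icc,
      Nat.add_sub_cancel, nsmul_eq_mul, hK]
    rw [← ENNReal.ofReal_natCast, ← ENNReal.ofReal_mul (by positivity),
      ← ENNReal.ofReal_mul (by positivity), ← ENNReal.ofReal_mul (by positivity),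
      ← ENNReal.ofReal_mul (by positivity)]
    congr 1
    have hN : (N : ℝ) ≠ 0 := by
      have : N ≠ 0 := by omega
      exact_mod_cast this
    field_simp
  rw [h2] at h1
  exact ENNReal.toReal_le_of_le_ofReal (by positivity) h1

/-! ### Counting the rounds with a crossing. -/

/-- The number of rounds among the first `T` in which `A` occurs. -/
def hits {E : Type*} (A : Set E) (T : ℕ) (w : ℕ → E) : ℝ :=
  ∑ t ∈ Finset.range T, A.indicator (fun _ => (1 : ℝ)) (w t)

theorem hits_mem_Icc {E : Type*} (A : Set E) (T : ℕ) (w : ℕ → E) : hits A T w ∈ Icc (0 : ℝ) T := by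
  have h : ∀ t, A.indicator (fun _ => (1 : ℝ)) (w t) ∈ Icc (0 : ℝ) 1 := by
    intro t
    by_cases ht : w t ∈ A <;> simp [ht]
  refine ⟨Finset.sum_nonneg fun t _ => (h t).1, ?_⟩
  refine (Finset.sum_le_sum fun t _ => (h t).2).trans_eq ?_
  simp

section hits

variable {E : Type*} [MeasurableSpace E] {A : Set E}

theorem measurable_hits (hA : MeasurableSet A) (T : ℕ) : Measurable (hits A T) :=
  Finset.measurable_sum _ fun t _ =>
    (measurable_const.indicator hA).comp (measurable_pi_apply t)

variable (μ : ℕ → Measure E) [∀ t, IsProbabilityMeasure (μ t)] {p : ℝ}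

theorem memLp_indicator_eval (hA : MeasurableSet A) (t : ℕ) :
    MemLp (fun w : ℕ → E => A.indicator (fun _ => (1 : ℝ)) (w t)) 2 (Measure.infinitePi μ) := by
  refine MemLp.of_bound (((measurable_const.indicator hA).comp
    (measurable_pi_apply t)).aestronglyMeasurable) 1 (Filter.Eventually.of_forall fun w => ?_)
  by_cases ht : w t ∈ A <;> simp [ht]

theorem integral_indicator_eval (hA : MeasurableSet A) (t : ℕ) :
    ∫ w : ℕ → E, A.indicator (fun _ => (1 : ℝ)) (w t) ∂(Measure.infinitePi μ) = (μ t).real A := by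
  have h := (measurePreserving_eval_infinitePi μ t).map_eq
  rw [← integral_indicator_one hA]
  conv_rhs => rw [← h]
  rw [integral_map (measurable_pi_apply t).aemeasurable
    ((measurable_const.indicator hA).aestronglyMeasurable)]
  rfl

theorem integral_hits_le (hA : MeasurableSet A) (hp : ∀ t, (μ t).real A ≤ p) (T : ℕ) :
    ∫ w, hits A T w ∂(Measure.infinitePi μ) ≤ T * p := by
  unfold hits
  rw [integral_finsetSum _ fun t _ => (memLp_indicator_eval μ hA t).integrable (by norm_num)]
  refine (Finset.sum_le_sum fun t _ => (integral_indicator_eval μ hA t).trans_le (hp t)).trans_eq ?_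
  simp

/-- Independence of the rounds makes variances additive, and the variance of an indicator is at most
its second moment, the probability of the event. -/
theorem variance_hits_le (hA : MeasurableSet A) (hp : ∀ t, (μ t).real A ≤ p) (T : ℕ) :
    ∫ w, (hits A T w - ∫ w', hits A T w' ∂(Measure.infinitePi μ)) ^ 2 ∂(Measure.infinitePi μ) ≤
      T * p := by
  rw [← variance_eq_integral (measurable_hits hA T).aemeasurable]
  have hsum : hits A T = ∑ t ∈ Finset.range T, fun w : ℕ → E =>
      A.indicator (fun _ => (1 : ℝ)) (w t) := by
    ext w
    simp [hits]
  have hind : iIndepFun (fun t (w : ℕ → E) => A.indicator (fun _ => (1 : ℝ)) (w t))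
      (Measure.infinitePi μ) :=
    iIndepFun_infinitePi (P := μ) (X := fun _ => A.indicator fun _ => (1 : ℝ)) fun _ =>
      measurable_const.indicator hA
  rw [hsum, IndepFun.variance_sum (fun t _ => memLp_indicator_eval μ hA t)
    fun t _ s _ hts => hind.indepFun hts]
  refine (Finset.sum_le_sum (g := fun _ => p) fun t _ => ?_).trans_eq (by simp)
  refine (variance_le_expectation_sq (memLp_indicator_eval μ hA t).1).trans ?_
  refine le_trans (le_of_eq ?_) ((integral_indicator_eval μ hA t).trans_le (hp t))
  refine integral_congr_ae (Filter.Eventually.of_forall fun w => ?_)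
  by_cases ht : w t ∈ A <;> simp [ht]

end hits

namespace MWISInstance

variable {n : ℕ} {V : GreedyVariant}

/-- The best parameter is not much better than some grid point, up to the rounds with crossings. -/
theorem exists_grid_cost (G : ℕ → SimpleGraph (Fin n)) {w : ℕ → Fin n → ℝ}
    (hw : ∀ t v, w t v ∈ Icc (0 : ℝ) 1) {N : ℕ} (hN : 0 < N) (T : ℕ) (r : Icc (0 : ℝ) 1) :
    ∃ i < N, ∑ t ∈ Finset.range T, (instances G w t).cost V r ≤
      ∑ t ∈ Finset.range T, (instances G w t).cost V ((i : ℝ) / N) +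
        n * hits (crossing n N i) T w := by
  have hN' : (0 : ℝ) < N := by exact_mod_cast hN
  have hN1 : (1 : ℝ) ≤ N := by exact_mod_cast hN
  obtain ⟨i, hi, hr⟩ : ∃ i < N, (r : ℝ) ∈ Icc ((i : ℝ) / N) (((i : ℝ) + 1) / N) := by
    have h0 := r.2.1
    have h1 := r.2.2
    rcases h1.lt_or_eq with h1 | h1
    · refine ⟨⌊(r : ℝ) * N⌋₊, ?_, ?_, ?_⟩
      · rw [Nat.floor_lt (by positivity)]
        nlinarith
      · rw [div_le_iff₀ hN']
        exact Nat.floor_le (by positivity)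
      · rw [le_div_iff₀ hN']
        exact (Nat.lt_floor_add_one _).le
    -- The endpoint `r = 1` belongs to the last cell, where the floor would give the inadmissible
    -- index `N`.
    · refine ⟨N - 1, by omega, ?_, ?_⟩
      · rw [h1]
        exact div_le_one_of_le₀ (by exact_mod_cast Nat.sub_le N 1) hN'.le
      · rw [h1, le_div_iff₀ hN']
        push_cast [Nat.cast_sub hN]
        linarith
  refine ⟨i, hi, ?_⟩
  rw [hits, Finset.mul_sum, ← Finset.sum_add_distrib]
  refine Finset.sum_le_sum fun t _ => ?_
  by_cases ht : w t ∈ crossing n N i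
  · rw [indicator_of_mem ht]
    have h1 := cost_mem_Icc (V := V) (x := instances G w t) (hw t) r
    have h2 := cost_mem_Icc (V := V) (x := instances G w t) (hw t) ((i : ℝ) / N)
    linarith [h1.2, h2.1]
  · rw [indicator_of_notMem ht, mul_zero, add_zero]
    exact (cost_congr (sameOrder_of_notMem_crossing (fun v => (hw t v).1) ht hr)).le

end MWISInstance
end

/-! ### The expected regret. -/

noncomputable section

open ProbabilityTheory RealRAM MWISInstance

variable {n : ℕ} {V : GreedyVariant} {σ : ℝ} {p q : ℕ}

/-- The expected total performance of the learner, over its own random draws. -/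
def meanCost (V : GreedyVariant) (σ : ℝ) (p q : ℕ) (x : ℕ → MWISInstance n) (T : ℕ) : ℝ :=
  ∑ t ∈ Finset.range T, ∑ j ∈ Finset.range (gridSize n σ p),
    (x t).cost V ((j : ℝ) / gridSize n σ p) * (expertWeight V σ q (gridSize n σ p) x t j /
      ∑ l ∈ Finset.range (gridSize n σ p), expertWeight V σ q (gridSize n σ p) x t l)

theorem expertWeight_pos (hn : 1 ≤ n) (hσ : 0 < σ) {x : ℕ → MWISInstance n}
    (hx : ∀ t v, (x t).weight v ∈ Icc (0 : ℝ) 1) (N t i : ℕ) :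
    0 < expertWeight V σ q N x t i := by
  refine Finset.prod_pos fun s _ => ?_
  have := (cost_mem_Icc (V := V) (hx s) ((i : ℝ) / N)).1
  positivity

/-- This is `hedge_regret_le` for the gains `cost / n`, which lie in `[0, 1]`, multiplied back by
`n`. -/
theorem sum_cost_grid_le (hn : 1 ≤ n) (hσ : 0 < σ) {x : ℕ → MWISInstance n}
    (hx : ∀ t v, (x t).weight v ∈ Icc (0 : ℝ) 1) (T : ℕ) {i : ℕ} (hi : i < gridSize n σ p) :
    ∑ t ∈ Finset.range T, (x t).cost V ((i : ℝ) / gridSize n σ p) ≤ meanCost V σ p q x T +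
      n * (1 / ((n : ℝ) + 1 / σ) ^ q * T + gridSize n σ p * ((n : ℝ) + 1 / σ) ^ q) := by
  have hn0 : (0 : ℝ) < n := by exact_mod_cast hn
  have hε : 0 < 1 / ((n : ℝ) + 1 / σ) ^ q := by positivity
  have h := hedge_regret_le (N := gridSize n σ p) hε
    (g := fun t i => (x t).cost V ((i : ℝ) / gridSize n σ p) / n)
    (W := expertWeight V σ q (gridSize n σ p) x)
    (fun t j _ => by
      have := cost_mem_Icc (V := V) (hx t) ((j : ℝ) / gridSize n σ p)
      exact ⟨div_nonneg this.1 hn0.le, div_le_one_of_le₀ this.2 hn0.le⟩)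
    (fun j _ => by simp [expertWeight])
    (fun t j _ => by
      rw [expertWeight, expertWeight, Finset.prod_range_succ]
      congr 2
      field_simp) T hi
  rw [div_div_eq_mul_div, div_one] at h
  have h2 := mul_le_mul_of_nonneg_left h hn0.le
  have e1 : (n : ℝ) * ∑ t ∈ Finset.range T, (x t).cost V ((i : ℝ) / gridSize n σ p) / n =
      ∑ t ∈ Finset.range T, (x t).cost V ((i : ℝ) / gridSize n σ p) := by
    rw [Finset.mul_sum]
    exact Finset.sum_congr rfl fun t _ => mul_div_cancel₀ _ hn0.ne'
  have e2 : (n : ℝ) * ∑ t ∈ Finset.range T, ∑ j ∈ Finset.range (gridSize n σ p),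
      (x t).cost V ((j : ℝ) / gridSize n σ p) / n * (expertWeight V σ q (gridSize n σ p) x t j /
      ∑ l ∈ Finset.range (gridSize n σ p), expertWeight V σ q (gridSize n σ p) x t l) =
      meanCost V σ p q x T := by
    rw [Finset.mul_sum]
    refine Finset.sum_congr rfl fun t _ => ?_
    rw [Finset.mul_sum]
    refine Finset.sum_congr rfl fun j _ => ?_
    rw [← mul_assoc, mul_div_cancel₀ _ hn0.ne']
  rw [e1, add_assoc, mul_add, e2] at h2
  exact h2

/-- The sum over all grid cells of the squared deviation of the number of crossings. -/
def crossingDeviation (N T : ℕ) (P : Measure (ℕ → Fin n → ℝ)) (w : ℕ → Fin n → ℝ) : ℝ :=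
  ∑ i ∈ Finset.range N, (hits (crossing n N i) T w - ∫ w', hits (crossing n N i) T w' ∂P) ^ 2

/-- The cell of the best parameter depends on `w`, so its deviation is bounded by a quantity
independent of the cell, `crossingDeviation`, whose expectation is computable. -/
theorem iSup_cost_le (hn : 1 ≤ n) (hσ : 0 < σ) (hσ1 : σ < 1) (G : ℕ → SimpleGraph (Fin n))
    {w : ℕ → Fin n → ℝ} (hw : ∀ t v, w t v ∈ Icc (0 : ℝ) 1) {T : ℕ} (hT : 0 < T)
    (P : Measure (ℕ → Fin n → ℝ)) {m δ : ℝ} (hδ : 0 < δ)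
    (hm : ∀ i < gridSize n σ p, ∫ w', hits (crossing n (gridSize n σ p) i) T w' ∂P ≤ T * m) :
    ⨆ r : Icc (0 : ℝ) 1, ∑ t ∈ Finset.range T, (instances G w t).cost V r ≤
      meanCost V σ p q (instances G w) T +
      (n * (1 / ((n : ℝ) + 1 / σ) ^ q * T + gridSize n σ p * ((n : ℝ) + 1 / σ) ^ q) +
      n * (T * m + δ * T + crossingDeviation (gridSize n σ p) T P w / (4 * (δ * T)))) := by
  refine ciSup_le fun r => ?_
  obtain ⟨i, hi, hr⟩ := exists_grid_cost (V := V) G hw (gridSize_pos (p := p) hn hσ hσ1) T r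
  have h1 := sum_cost_grid_le (V := V) (q := q) hn hσ (x := instances G w) hw T hi
  have h2 : hits (crossing n (gridSize n σ p) i) T w ≤
      T * m + δ * T + crossingDeviation (gridSize n σ p) T P w / (4 * (δ * T)) := by
    have hT' : (0 : ℝ) < T := by exact_mod_cast hT
    have hm' := hm i hi
    set z := hits (crossing n (gridSize n σ p) i) T w -
      ∫ w', hits (crossing n (gridSize n σ p) i) T w' ∂P with hz
    have h3 : z ^ 2 ≤ crossingDeviation (gridSize n σ p) T P w :=
      Finset.single_le_sum (f := fun i => (hits (crossing n (gridSize n σ p) i) T w -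
        ∫ w', hits (crossing n (gridSize n σ p) i) T w' ∂P) ^ 2) (fun _ _ => sq_nonneg _)
        (Finset.mem_range.2 hi)
    have ha : 0 < δ * T := by positivity
    -- This is `(z - 2 * δ * T) ^ 2 ≥ 0`. It makes the deviation enter through its square only.
    have h4 : z ≤ δ * T + z ^ 2 / (4 * (δ * T)) := by
      rw [← sub_le_iff_le_add', le_div_iff₀ (by positivity)]
      nlinarith [sq_nonneg (z - 2 * (δ * T))]
    have h5 := div_le_div_of_nonneg_right h3 (by positivity : 0 ≤ 4 * (δ * T))
    linarith
  have h3 := mul_le_mul_of_nonneg_left h2 (Nat.cast_nonneg (α := ℝ) n)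
  linarith

theorem measurable_expertWeight (G : ℕ → SimpleGraph (Fin n)) (N t i : ℕ) :
    Measurable fun w : ℕ → Fin n → ℝ => expertWeight V σ q N (instances G w) t i := by
  refine Finset.measurable_prod _ fun s _ => ?_
  exact measurable_const.add (((measurable_cost (V := V) (G s)).comp
    (measurable_const.prodMk (measurable_pi_apply s))).div_const _)

theorem measurable_expert (G : ℕ → SimpleGraph (Fin n)) (t : ℕ) :
    Measurable fun z : (ℕ → Fin n → ℝ) × (ℕ → unitInterval) =>
      expert V σ p q (instances G z.1) t (z.2 t) := by
  have h := measurable_expertWeight (V := V) (σ := σ) (q := q) G (gridSize n σ p) t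
  refine measurable_pick (fun i => (h i).comp measurable_fst) (Measurable.mul ?_ ?_) _
  · exact measurable_subtype_coe.comp ((measurable_pi_apply t).comp measurable_snd)
  · exact Finset.measurable_sum _ fun i _ => (h i).comp measurable_fst

theorem ae_weights_mem {Δ : ℕ → Fin n → ProbabilityMeasure ℝ}
    (hΔ : ∀ t v, IsSmooth σ (Δ t v : Measure ℝ)) :
    ∀ᵐ w ∂(Measure.infinitePi fun t => Measure.pi fun v => (Δ t v : Measure ℝ)),
      ∀ t v, w t v ∈ Icc (0 : ℝ) 1 := by
  rw [ae_all_iff]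
  intro t
  rw [ae_all_iff]
  intro v
  have h1 := (measurePreserving_eval (fun v => (Δ t v : Measure ℝ)) v).quasiMeasurePreserving.ae
    (hΔ t v).ae_mem
  exact (measurePreserving_eval_infinitePi
    (fun t => Measure.pi fun v => (Δ t v : Measure ℝ)) t).quasiMeasurePreserving.ae h1

theorem integrable_regret (G : ℕ → SimpleGraph (Fin n))
    {Δ : ℕ → Fin n → ProbabilityMeasure ℝ} (hΔ : ∀ t v, IsSmooth σ (Δ t v : Measure ℝ)) (T : ℕ) :
    Integrable (fun z : (ℕ → Fin n → ℝ) × (ℕ → unitInterval) =>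
      regret V (instances G z.1) ((hedge V p q).action σ z.2 (instances G z.1)) T)
      (smoothLaw Δ) := by
  have hgood : ∀ᵐ z ∂(smoothLaw Δ), ∀ t v, z.1 t v ∈ Icc (0 : ℝ) 1 :=
    Measure.quasiMeasurePreserving_fst.ae (ae_weights_mem hΔ)
  have hprob : IsProbabilityMeasure (smoothLaw Δ) := by
    unfold smoothLaw
    infer_instance
  have hmeas : Measurable fun z : (ℕ → Fin n → ℝ) × (ℕ → unitInterval) =>
      (1 / (T : ℝ)) * ((⨆ r : Icc (0 : ℝ) 1,
        ∑ t ∈ Finset.range T, (instances G z.1 t).cost V r) - ∑ t ∈ Finset.range T,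
          (instances G z.1 t).cost V ((expert V σ p q (instances G z.1) t (z.2 t) : ℝ) /
            gridSize n σ p)) := by
    refine measurable_const.mul (Measurable.sub ((measurable_iSup_cost G T).comp measurable_fst)
      (Finset.measurable_sum _ fun t _ => ?_))
    refine (measurable_cost (V := V) (G t)).comp (Measurable.prodMk ?_
      ((measurable_pi_apply t).comp measurable_fst))
    exact ((measurable_from_top (f := fun k : ℕ => (k : ℝ))).comp
      (measurable_expert G t)).div_const _
  -- The description of the action by `expert` needs nonnegative weights, so the regret is only
  -- shown to agree almost everywhere with a measurable function.
  refine Integrable.of_bound ⟨_, hmeas.stronglyMeasurable, ?_⟩ ((1 / (T : ℝ)) * (T * n)) ?_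
  · filter_upwards [hgood] with z hz
    rw [regret]
    simp only [hedge_action z.2 (x := instances G z.1) (fun t v => (hz t v).1)]
  · filter_upwards [hgood] with z hz
    have hb : ∀ ρ : ℕ → ℝ, ∑ t ∈ Finset.range T, (instances G z.1 t).cost V (ρ t) ∈
        Icc (0 : ℝ) (T * n) := by
      intro ρ
      have h : ∀ t, (instances G z.1 t).cost V (ρ t) ∈ Icc (0 : ℝ) n := fun t =>
        cost_mem_Icc (hz t) _
      refine ⟨Finset.sum_nonneg fun t _ => (h t).1, ?_⟩
      refine (Finset.sum_le_sum fun t _ => (h t).2).trans_eq (by simp)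
    have h1 := hb ((hedge V p q).action σ z.2 (instances G z.1))
    have h2 : ⨆ r : Icc (0 : ℝ) 1, ∑ t ∈ Finset.range T, (instances G z.1 t).cost V r ≤ T * n :=
      ciSup_le fun r => (hb fun _ => r).2
    have h3 : 0 ≤ ⨆ r : Icc (0 : ℝ) 1, ∑ t ∈ Finset.range T, (instances G z.1 t).cost V r :=
      Real.iSup_nonneg fun r => (hb fun _ => r).1
    rw [regret, norm_mul, Real.norm_of_nonneg (by positivity), Real.norm_eq_abs]
    refine mul_le_mul_of_nonneg_left (abs_le.2 ⟨?_, ?_⟩) (by positivity)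
    · linarith [h1.2]
    · linarith [h1.1]

/-- For fixed instances the action of round `t` is a function of `U t` alone, so linearity reduces
the claim to `integral_pick` in each round. -/
theorem integral_regret_draws (hn : 1 ≤ n) (hσ : 0 < σ) (hσ1 : σ < 1) {x : ℕ → MWISInstance n}
    (hx : ∀ t v, (x t).weight v ∈ Icc (0 : ℝ) 1) (T : ℕ) :
    ∫ U, regret V x ((hedge V p q).action σ U x) T
      ∂(Measure.infinitePi fun _ : ℕ => (volume : Measure unitInterval)) =
      (1 / (T : ℝ)) * ((⨆ r : Icc (0 : ℝ) 1, ∑ t ∈ Finset.range T, (x t).cost V r) -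
        meanCost V σ p q x T) := by
  simp only [regret, hedge_action _ (fun t v => (hx t v).1)]
  let f : ℕ → ℕ → ℝ := fun t k => (x t).cost V ((k : ℝ) / gridSize n σ p)
  have hmeas : ∀ t, Measurable fun u : unitInterval => f t (expert V σ p q x t u) := fun t =>
    (measurable_from_top (f := f t)).comp
      (measurable_pick (W := fun _ => expertWeight V σ q (gridSize n σ p) x t)
        (fun _ => measurable_const) (measurable_subtype_coe.mul_const _) _)
  have hint : ∀ t, Integrable (fun U : ℕ → unitInterval => f t (expert V σ p q x t (U t)))
      (Measure.infinitePi fun _ : ℕ => (volume : Measure unitInterval)) := by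
    intro t
    refine Integrable.of_bound ((hmeas t).comp (measurable_pi_apply t)).aestronglyMeasurable n
      (Filter.Eventually.of_forall fun U => ?_)
    have := cost_mem_Icc (V := V) (hx t) ((expert V σ p q x t (U t) : ℝ) / gridSize n σ p)
    rw [Real.norm_of_nonneg this.1]
    exact this.2
  have hval : ∀ t, ∫ U : ℕ → unitInterval, f t (expert V σ p q x t (U t))
      ∂(Measure.infinitePi fun _ : ℕ => (volume : Measure unitInterval)) =
      ∑ j ∈ Finset.range (gridSize n σ p), f t j * (expertWeight V σ q (gridSize n σ p) x t j /
        ∑ l ∈ Finset.range (gridSize n σ p), expertWeight V σ q (gridSize n σ p) x t l) := by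
    intro t
    rw [← integral_pick (gridSize_pos hn hσ hσ1).ne' fun j _ => expertWeight_pos hn hσ hx _ t j]
    have h := (measurePreserving_eval_infinitePi
      (fun _ : ℕ => (volume : Measure unitInterval)) t).map_eq
    conv_rhs => rw [← h]
    rw [integral_map (measurable_pi_apply t).aemeasurable (hmeas t).aestronglyMeasurable]
    rfl
  rw [integral_const_mul, integral_sub (integrable_const _)
    (integrable_finsetSum _ fun t _ => hint t), integral_const, probReal_univ, one_smul,
    integral_finsetSum _ fun t _ => hint t, Finset.sum_congr rfl fun t _ => hval t]
  rfl

/-- A bound for the expected regret in terms of the parameters of the algorithm. -/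
theorem integral_regret_le (hn : 1 ≤ n) (hσ : 0 < σ) (hσ1 : σ < 1) (G : ℕ → SimpleGraph (Fin n))
    {Δ : ℕ → Fin n → ProbabilityMeasure ℝ} (hΔ : ∀ t v, IsSmooth σ (Δ t v : Measure ℝ)) {T : ℕ}
    (hT : 0 < T) {δ : ℝ} (hδ : 0 < δ) :
    ∫ z, regret V (instances G z.1) ((hedge V p q).action σ z.2 (instances G z.1)) T
      ∂(smoothLaw Δ) ≤
    n * (1 / ((n : ℝ) + 1 / σ) ^ q + gridSize n σ p * ((n : ℝ) + 1 / σ) ^ q / T +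
      (n : ℝ) ^ 6 / (gridSize n σ p * σ) + δ + ((n : ℝ) ^ 6 / σ) / (4 * (δ * T))) := by
  have hT' : (0 : ℝ) < T := by exact_mod_cast hT
  set N := gridSize n σ p with hN
  have hN0 : (0 : ℝ) < N := by exact_mod_cast gridSize_pos (p := p) hn hσ hσ1
  set μ : ℕ → Measure (Fin n → ℝ) := fun t => Measure.pi fun v => (Δ t v : Measure ℝ) with hμ
  have hμp : ∀ t, IsProbabilityMeasure (μ t) := fun t => by rw [hμ]; infer_instance
  set P := Measure.infinitePi μ with hP
  set m : ℝ := (n : ℝ) ^ 6 / (N * σ) with hm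
  have hcross : ∀ i < N, ∀ t, (μ t).real (crossing n N i) ≤ m := fun i hi t =>
    measure_crossing_le hσ (hΔ t) hi
  have hint := integrable_regret (V := V) (p := p) (q := q) G hΔ T
  have hdev : ∀ i, Integrable (fun w => (hits (crossing n N i) T w -
      ∫ w', hits (crossing n N i) T w' ∂P) ^ 2) P := by
    intro i
    have hI : ∫ w', hits (crossing n N i) T w' ∂P ∈ Icc (0 : ℝ) T := by
      constructor
      · exact integral_nonneg fun w => (hits_mem_Icc _ T w).1
      · have h1 : Integrable (hits (crossing n N i) T) P :=
          Integrable.of_bound (measurable_hits (measurableSet_crossing n N i) T).aestronglyMeasurable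
            T (Filter.Eventually.of_forall fun w => by
              rw [Real.norm_of_nonneg (hits_mem_Icc _ T w).1]; exact (hits_mem_Icc _ T w).2)
        refine (integral_mono h1 (integrable_const (T : ℝ)) fun w => (hits_mem_Icc _ T w).2).trans ?_
        simp
    refine Integrable.of_bound (((measurable_hits (measurableSet_crossing n N i) T).sub_const
      _).pow_const 2).aestronglyMeasurable ((T : ℝ) ^ 2) (Filter.Eventually.of_forall fun w => ?_)
    rw [Real.norm_of_nonneg (sq_nonneg _)]
    have h1 := hits_mem_Icc (crossing n N i) T w
    exact sq_le_sq' (by linarith [h1.1, hI.2]) (by linarith [h1.2, hI.1])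
  have hdevI : ∫ w, crossingDeviation N T P w ∂P ≤ N * (T * m) := by
    unfold crossingDeviation
    rw [integral_finsetSum _ fun i _ => hdev i]
    refine (Finset.sum_le_sum fun i hi => variance_hits_le μ (measurableSet_crossing n N i)
      (hcross i (Finset.mem_range.1 hi)) T).trans_eq ?_
    simp
  have hdevint : Integrable (crossingDeviation N T P) P := integrable_finsetSum _ fun i _ => hdev i
  set c : ℝ := n * (1 / ((n : ℝ) + 1 / σ) ^ q * T + N * ((n : ℝ) + 1 / σ) ^ q) +
    n * (T * m + δ * T) with hc
  have hbound : ∀ᵐ w ∂P, ∫ U, regret V (instances G w)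
      ((hedge V p q).action σ U (instances G w)) T
      ∂(Measure.infinitePi fun _ : ℕ => (volume : Measure unitInterval)) ≤
      (1 / (T : ℝ)) * (c + n / (4 * (δ * T)) * crossingDeviation N T P w) := by
    filter_upwards [ae_weights_mem hΔ] with w hw
    rw [integral_regret_draws hn hσ hσ1 (x := instances G w) hw]
    refine mul_le_mul_of_nonneg_left ?_ (by positivity)
    have h := iSup_cost_le (V := V) (p := p) (q := q) hn hσ hσ1 G hw hT P hδ (m := m)
      (fun i hi => integral_hits_le μ (measurableSet_crossing n N i) (hcross i hi) T)
    rw [← hN] at h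
    rw [hc, sub_le_iff_le_add']
    refine h.trans_eq ?_
    ring
  have hnonneg : 0 ≤ (n : ℝ) / (4 * (δ * T)) := by positivity
  calc _ = ∫ w, ∫ U, regret V (instances G w) ((hedge V p q).action σ U (instances G w)) T
        ∂(Measure.infinitePi fun _ : ℕ => (volume : Measure unitInterval)) ∂P :=
        integral_prod _ hint
    _ ≤ ∫ w, (1 / (T : ℝ)) * (c + n / (4 * (δ * T)) * crossingDeviation N T P w) ∂P :=
        integral_mono_ae hint.integral_prod_left
          (((integrable_const _).add (hdevint.const_mul _)).const_mul _) hbound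
    _ = (1 / (T : ℝ)) * (c + n / (4 * (δ * T)) * ∫ w, crossingDeviation N T P w ∂P) := by
        rw [integral_const_mul, integral_add (integrable_const _) (hdevint.const_mul _),
          integral_const_mul, integral_const, probReal_univ, one_smul]
    _ ≤ (1 / (T : ℝ)) * (c + n / (4 * (δ * T)) * (N * (T * m))) := by gcongr
    _ = _ := by
        -- The factor `N` from summing over all cells cancels the `1 / N` in the crossing
        -- probability.
        have hmN : (N : ℝ) * m = (n : ℝ) ^ 6 / σ := by
          rw [hm]
          field_simp
        have : (N : ℝ) * (T * m) = T * ((n : ℝ) ^ 6 / σ) := by rw [← hmN]; ring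
        rw [this, hc]
        field_simp
        ring

/-! ### The choice of the exponents. -/

theorem gridSize_le (hn : 1 ≤ n) (hσ : 0 < σ) (hσ1 : σ < 1) (p : ℕ) :
    (gridSize n σ p : ℝ) ≤ 2 * ((n : ℝ) + 1 / σ) ^ p := by
  have h1 := Nat.ceil_lt_add_one (a := ((n : ℝ) + 1 / σ) ^ p) (by positivity)
  have h2 : 1 ≤ ((n : ℝ) + 1 / σ) ^ p := one_le_pow₀ (by linarith [two_le_scale hn hσ hσ1])
  rw [gridSize]
  linarith

/-- The parameters of the algorithm make the expected regret small. -/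
theorem regret_bound_le (d : ℕ) (hn : 1 ≤ n) (hσ : 0 < σ) (hσ1 : σ < 1) {T : ℝ}
    (hT : ((n : ℝ) + 1 / σ) ^ (3 * d + 21) ≤ T) :
    n * (1 / ((n : ℝ) + 1 / σ) ^ (d + 4) +
      gridSize n σ (d + 12) * ((n : ℝ) + 1 / σ) ^ (d + 4) / T +
      (n : ℝ) ^ 6 / (gridSize n σ (d + 12) * σ) + 1 / ((n : ℝ) + 1 / σ) ^ (d + 4) +
      ((n : ℝ) ^ 6 / σ) / (4 * (1 / ((n : ℝ) + 1 / σ) ^ (d + 4) * T))) ≤ 1 / (n : ℝ) ^ d := by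
  have hN := gridSize_le hn hσ hσ1 (d + 12)
  have hN' : ((n : ℝ) + 1 / σ) ^ (d + 12) ≤ gridSize n σ (d + 12) := Nat.le_ceil _
  set y : ℝ := (n : ℝ) + 1 / σ with hy
  have hy2 : 2 ≤ y := two_le_scale hn hσ hσ1
  have hn1 : (1 : ℝ) ≤ n := by exact_mod_cast hn
  have hny : (n : ℝ) ≤ y := by rw [hy]; have : 0 < 1 / σ := by positivity
                               linarith
  have hσy : 1 / σ ≤ y := by rw [hy]; linarith
  have hy0 : 0 < y := by linarith
  have h6 : (n : ℝ) ^ 6 / σ ≤ y ^ 7 := by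
    rw [div_eq_mul_one_div]
    calc (n : ℝ) ^ 6 * (1 / σ) ≤ y ^ 6 * y := by gcongr
      _ = y ^ 7 := by ring
  have hT0 : 0 < T := lt_of_lt_of_le (by positivity) hT
  set N : ℝ := (gridSize n σ (d + 12) : ℝ) with hNdef
  have hN0 : 0 < N := lt_of_lt_of_le (by positivity) hN'
  have hD : 0 < y ^ d := by positivity
  have b1 : 1 / y ^ (d + 4) = 1 / (y ^ d * y ^ 4) := by rw [pow_add]
  have hTT : y ^ d * y ^ d * y ^ d * y ^ 21 ≤ T := by
    refine le_of_eq_of_le ?_ hT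
    ring
  have hy4 : 16 ≤ y ^ 4 := by
    calc (16 : ℝ) = 2 ^ 4 := by norm_num
      _ ≤ y ^ 4 := by gcongr
  have hy3 : 8 ≤ y ^ 3 := by
    calc (8 : ℝ) = 2 ^ 3 := by norm_num
      _ ≤ y ^ 3 := by gcongr
  have hd1 : 1 ≤ y ^ d := one_le_pow₀ (by linarith)
  -- Each of the five summands is at most an eighth of `1 / y ^ d`; this one occurs twice, for the
  -- learning rate and for `δ`. The exponent `d + 4` leaves `y ^ 3 ≥ 8` to spare.
  have t1 : y * (1 / y ^ (d + 4)) ≤ 1 / y ^ d / 8 := by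
    rw [b1, mul_one_div, div_div, div_le_div_iff₀ (by positivity) (by positivity)]
    calc y * (y ^ d * 8) ≤ y * (y ^ d * y ^ 3) := by gcongr
      _ = 1 * (y ^ d * y ^ 4) := by ring
  -- This term dictates `T`: the exponents `1`, `d + 12`, `d + 4` and `d` add up to `3 * d + 17`,
  -- and `y ^ 4` absorbs the factor `16`.
  have t2 : y * (N * y ^ (d + 4) / T) ≤ 1 / y ^ d / 8 := by
    rw [← mul_div_assoc, div_div, div_le_div_iff₀ hT0 (by positivity), one_mul]
    refine le_trans ?_ hTT
    calc y * (N * y ^ (d + 4)) * (y ^ d * 8) ≤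
          y * ((2 * y ^ (d + 12)) * y ^ (d + 4)) * (y ^ d * 8) := by gcongr
      _ = 16 * (y ^ d * y ^ d * y ^ d * y ^ 17) := by ring
      _ ≤ y ^ 4 * (y ^ d * y ^ d * y ^ d * y ^ 17) := by gcongr
      _ = _ := by ring
  -- This term dictates the grid: `1 + 7 + d`, and `y ^ 4` absorbs the factor `8`.
  have t3 : y * ((n : ℝ) ^ 6 / (N * σ)) ≤ 1 / y ^ d / 8 := by
    have e : (n : ℝ) ^ 6 / (N * σ) = (n : ℝ) ^ 6 / σ / N := by rw [div_div, mul_comm N]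
    rw [e, ← mul_div_assoc, div_div, div_le_div_iff₀ hN0 (by positivity), one_mul]
    refine le_trans ?_ hN'
    calc y * ((n : ℝ) ^ 6 / σ) * (y ^ d * 8) ≤ y * y ^ 7 * (y ^ d * y ^ 4) := by
          gcongr
          linarith
      _ = y ^ (d + 12) := by ring
  have t5 : y * ((n : ℝ) ^ 6 / σ / (4 * (1 / y ^ (d + 4) * T))) ≤ 1 / y ^ d / 8 := by
    have e : (n : ℝ) ^ 6 / σ / (4 * (1 / y ^ (d + 4) * T)) =
        (n : ℝ) ^ 6 / σ * y ^ (d + 4) / (4 * T) := by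
      field_simp
    rw [e, ← mul_div_assoc, div_div, div_le_div_iff₀ (by positivity) (by positivity), one_mul]
    calc y * ((n : ℝ) ^ 6 / σ * y ^ (d + 4)) * (y ^ d * 8) ≤
          y * (y ^ 7 * y ^ (d + 4)) * (y ^ d * y ^ 3) := by gcongr
      _ = 1 * (y ^ d * y ^ d * y ^ 15) := by ring
      _ ≤ y ^ d * (y ^ d * y ^ d * y ^ 15) := by gcongr
      _ = y ^ d * y ^ d * y ^ d * y ^ 15 := by ring
      _ ≤ y ^ d * y ^ d * y ^ d * y ^ 21 := by
          gcongr
          · linarith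
          · norm_num
      _ ≤ 4 * T := by linarith
  have hlast : 1 / y ^ d ≤ 1 / (n : ℝ) ^ d := by
    apply one_div_le_one_div_of_le (by positivity)
    gcongr
  have hpos : 0 < 1 / y ^ d := by positivity
  refine le_trans ?_ hlast
  refine le_trans (mul_le_mul_of_nonneg_right hny (by positivity)) ?_
  rw [mul_add, mul_add, mul_add, mul_add]
  linarith

theorem theorem4p5 (V : GreedyVariant) (d : ℕ) :
    ∃ (L : Learner) (C : ℕ), ∀ (n : ℕ) (σ : ℝ), 1 ≤ n → 0 < σ → σ < 1 →
      -- running time in every round, and legality of the choices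
      (∀ (x : ℕ → MWISInstance n) (U : ℕ → unitInterval),
        (∀ t v, (x t).weight v ∈ Icc (0 : ℝ) 1) →
          ((L.memory σ U x 0).time : ℝ) ≤ C * ((n : ℝ) + 1 / σ) ^ C ∧
          ∀ t, ((L.memory σ U x (t + 1)).time : ℝ) ≤
              (L.memory σ U x t).time + C * ((n : ℝ) + 1 / σ) ^ C ∧
            L.action σ U x t ∈ Icc (0 : ℝ) 1) ∧
      -- expected regret
      (∀ (G : ℕ → SimpleGraph (Fin n)) (Δ : ℕ → Fin n → ProbabilityMeasure ℝ),
        (∀ t v, IsSmooth σ (Δ t v : Measure ℝ)) →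
        ∀ T : ℕ, C * ((n : ℝ) + 1 / σ) ^ C ≤ (T : ℝ) →
          Integrable (fun p : (ℕ → Fin n → ℝ) × (ℕ → unitInterval) =>
            regret V (instances G p.1) (L.action σ p.2 (instances G p.1)) T) (smoothLaw Δ) ∧
          ∫ p, regret V (instances G p.1) (L.action σ p.2 (instances G p.1)) T ∂(smoothLaw Δ) ≤
            1 / (n : ℝ) ^ d) := by
  obtain ⟨K, hK⟩ := hedge_time V (d + 12) (d + 4)
  -- The summands of the constant dominate, in turn, the exponent and the coefficient of the running
  -- time, where `n + N + 1 ≤ y ^ (d + 14)`, and the exponent of the least admissible `T`.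
  refine ⟨hedge V (d + 12) (d + 4), (d + 14) * K + K + (3 * d + 21), fun n σ hn hσ hσ1 => ?_⟩
  set C := (d + 14) * K + K + (3 * d + 21) with hC
  have hy2 : 2 ≤ (n : ℝ) + 1 / σ := two_le_scale hn hσ hσ1
  constructor
  · intro x U hx
    have hx0 : ∀ t v, 0 ≤ (x t).weight v := fun t v => (hx t v).1
    have hpoly : (K : ℝ) * ((n : ℝ) + gridSize n σ (d + 12) + 1) ^ K ≤
        C * ((n : ℝ) + 1 / σ) ^ C := by
      have hN := gridSize_le hn hσ hσ1 (d + 12)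
      have hny : (n : ℝ) ≤ (n : ℝ) + 1 / σ := by
        have : 0 < 1 / σ := by positivity
        linarith
      set y : ℝ := (n : ℝ) + 1 / σ
      have h1 : y ≤ y ^ (d + 12) := le_self_pow₀ (by linarith) (by omega)
      have h2 : 1 ≤ y ^ (d + 12) := one_le_pow₀ (by linarith)
      have h3 : (n : ℝ) + gridSize n σ (d + 12) + 1 ≤ y ^ (d + 14) := by
        calc _ ≤ y ^ (d + 12) * 2 ^ 2 := by linarith
          _ ≤ y ^ (d + 12) * y ^ 2 := by gcongr
          _ = y ^ (d + 14) := by ring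
      calc (K : ℝ) * ((n : ℝ) + gridSize n σ (d + 12) + 1) ^ K ≤ K * (y ^ (d + 14)) ^ K := by
            gcongr
        _ = K * y ^ ((d + 14) * K) := by rw [pow_mul]
        _ ≤ C * y ^ C := by
            gcongr
            · omega
            · linarith
            · omega
    obtain ⟨k1, k2⟩ := hK n σ x U hx0
    refine ⟨le_trans (by exact_mod_cast k1) hpoly, fun t =>
      ⟨?_, hedge_action_mem hn hσ hσ1 U hx0 t⟩⟩
    have h : (((hedge V (d + 12) (d + 4)).memory σ U x (t + 1)).time : ℝ) ≤
      ((hedge V (d + 12) (d + 4)).memory σ U x t).time +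
        K * ((n : ℝ) + gridSize n σ (d + 12) + 1) ^ K := by exact_mod_cast k2 t
    linarith
  · intro G Δ hΔ T hT
    have hT1 : ((n : ℝ) + 1 / σ) ^ (3 * d + 21) ≤ T := by
      refine le_trans ?_ hT
      have h1 : (1 : ℝ) ≤ C := by exact_mod_cast (by omega : 1 ≤ C)
      calc ((n : ℝ) + 1 / σ) ^ (3 * d + 21) ≤ ((n : ℝ) + 1 / σ) ^ C := by
            gcongr
            · linarith
            · omega
        _ ≤ C * ((n : ℝ) + 1 / σ) ^ C := le_mul_of_one_le_left (by positivity) h1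
    have hT0 : 0 < T := by
      have : (0 : ℝ) < T := lt_of_lt_of_le (by positivity) hT1
      exact_mod_cast this
    refine ⟨integrable_regret G hΔ T, ?_⟩
    exact (integral_regret_le hn hσ hσ1 G hΔ hT0 (δ := 1 / ((n : ℝ) + 1 / σ) ^ (d + 4))
      (by positivity)).trans (regret_bound_le d hn hσ hσ1 hT1)
end
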